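/- Let $N\ge 1$, $0<\alpha<1$, $p_F:=1+\frac2N$. Let $h_\alpha$ be the probability density on $(0,\infty)$ with $\int_0^\infty h_\alpha(\theta)e^{z\theta}\,d\theta=\sum_{k\ge0}\frac{z^k}{\Gamma(\alpha k+1)}$ for $z\in\mathbf C$ (the M-Wright function), let $G(t,x)=(4\pi t)^{-N/2}e^{-|x|^2/(4t)}$, $e^{t\Delta}\mu(x)=\int_{\mathbf R^N}G(t,x-y)\,d\mu(y)$ and $$P_\alpha(t)=\int_0^\infty h_\alpha(\theta)\,e^{t^\alpha\theta\Delta}\,d\theta,\qquad S_\alpha(t)=\int_0^\infty \theta h_\alpha(\theta)\,e^{t^\alpha\theta\Delta}\,d\theta .$$ For $0<T<\infty$, $p>1$ and a nonnegative Radon measure $\mu$ on $\mathbf R^N$, a solution in $[0,T]\times\mathbf R^N$ of the problem $$\partial_t^\alpha u-\Delta u=u^p\ \text{ in }(0,T)\times\mathbf R^N,\qquad u(0)=\mu\ \text{ in }\mathbf R^N,\tag{1}$$ where $\partial_t^\alpha$ is the Caputo derivative, is a nonnegative measurable function $u$ on $(0,T]\times\mathbf R^N$ such that $$\infty>u(t,x)=[P_\alpha(t)\mu](x)+\alpha\int_0^t(t-s)^{\alpha-1}[S_\alpha(t-s)u(s)^p](x)\,ds$$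 for almost all $t\in(0,T]$ and $x\in\mathbf R^N$. **Theorem.** For all $N\ge1$, $1<p\le p_F$ and $0<\alpha<1$ there is a constant $\gamma_2=\gamma_2(N,p,\alpha)>0$ with the following properties. (a) For every $T>0$ and every nonnegative Radon measure $\mu$ on $\mathbf R^N$ with $$\sup_{z\in\mathbf R^N}\mu\big(B(z,T^{\alpha/2})\big)\le\gamma_2\,T^{\alpha\left(\frac N2-\frac1{p-1}\right)},$$ problem (1) possesses a solution in $[0,T]\times\mathbf R^N$. (b) If $p\ne p_F$, then $\limsup_{\alpha\to1-0}\gamma_2(N,p,\alpha)\in(0,\infty)$. (c) If $p=p_F$, then there is $C=C(N)>0$ with $\gamma_2(N,p_F,\alpha)\le C(1-\alpha)^{N/2}$ for all $\alpha\in(0,1)$; this order is attained, that is, there is $c=c(N)>0$ with $\gamma_2(N,p_F,\alpha)\ge c\,(1-\alpha)^{N/2}$ for all $\alpha<1$ sufficiently close to $1$. -/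

import Mathlib

open MeasureTheory Set Filter Topology
open scoped ENNReal

namespace TimeFractional

theorem inv_Gamma_rec (y : ℝ) : (Real.Gamma y)⁻¹ = y * (Real.Gamma (y + 1))⁻¹ := by
  rcases eq_or_ne y 0 with rfl | h
  · simp
  · rw [Real.Gamma_add_one h, mul_inv, ← mul_assoc, mul_inv_cancel₀ h, one_mul]

theorem sum_choose_sinc (k : ℕ) : ∀ x : ℝ,
    ∑ j ∈ Finset.range (k + 1), (k.choose j : ℝ) * Real.sinc (Real.pi * (j - x)) =
      k.factorial * (Real.Gamma (1 + x))⁻¹ * (Real.Gamma (1 + k - x))⁻¹ := by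
  induction k with
  | zero =>
    intro x
    rcases eq_or_ne x 0 with rfl | h
    · simp
    · have h1 := Real.Gamma_mul_Gamma_one_sub x
      have h2 : Real.sinc (Real.pi * (-x)) = Real.sin (Real.pi * x) / (Real.pi * x) := by
        rw [mul_neg, Real.sinc_neg, Real.sinc_of_ne_zero (by positivity)]
      simp only [zero_add, Finset.range_one, Finset.sum_singleton, Nat.choose_self, Nat.cast_one,
        Nat.cast_zero, zero_sub, one_mul, Nat.factorial_zero, add_zero]
      rw [h2, add_comm 1 x, Real.Gamma_add_one h, ← mul_inv, mul_assoc, h1]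
      have := Real.pi_ne_zero
      field_simp
  | succ k ih =>
    intro x
    have h := Finset.sum_choose_succ_mul (fun i _ => Real.sinc (Real.pi * ((i : ℝ) - x))) k
    rw [h, ih x]
    have h2 : ∑ i ∈ Finset.range (k + 1), (k.choose i : ℝ) *
        Real.sinc (Real.pi * (((i + 1 : ℕ) : ℝ) - x)) =
        k.factorial * (Real.Gamma (1 + (x - 1)))⁻¹ * (Real.Gamma (1 + k - (x - 1)))⁻¹ := by
      rw [← ih (x - 1)]
      refine Finset.sum_congr rfl fun i _ => ?_
      congr 2
      push_cast; ring
    rw [h2]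
    have e1 := inv_Gamma_rec (1 + k - x)
    have e2 := inv_Gamma_rec x
    rw [show (1 + (x - 1)) = x by ring, e2, e1, show (1 : ℝ) + k - (x - 1) = 1 + k - x + 1 by ring,
      show (1 : ℝ) + ((k + 1 : ℕ) : ℝ) - x = 1 + k - x + 1 by push_cast; ring, add_comm x 1,
      Nat.factorial_succ]
    push_cast
    ring

/-- The trigonometric function in the Kanter--Zolotarev formula for one-sided stable laws. -/
noncomputable def kanter (α φ : ℝ) : ℝ :=
  Real.sin (α * φ) ^ α * Real.sin ((1 - α) * φ) ^ (1 - α) / Real.sin φ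

theorem sin_mul_pos {l φ : ℝ} (h0 : 0 < l) (h1 : l < 1) (hφ : φ ∈ Ioo 0 Real.pi) :
    0 < Real.sin (l * φ) :=
  Real.sin_pos_of_pos_of_lt_pi (mul_pos h0 hφ.1) (by nlinarith [hφ.1, hφ.2])

theorem kanter_pos {α φ : ℝ} (h0 : 0 < α) (h1 : α < 1) (hφ : φ ∈ Ioo 0 Real.pi) :
    0 < kanter α φ := by
  have a := sin_mul_pos h0 h1 hφ
  have b := sin_mul_pos (sub_pos.2 h1) (by linarith : 1 - α < 1) hφ
  have c := Real.sin_pos_of_pos_of_lt_pi hφ.1 hφ.2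
  unfold kanter
  positivity

/-- On the curve `z = (sin (α φ) / sin ((1 - α) φ)) e^{iφ}` the function `(1 + z) z ^ (-α)` is real and equal
to `(kanter α φ)⁻¹`. -/
theorem level_curve {α φ : ℝ} (h0 : 0 < α) (h1 : α < 1) (hφ : φ ∈ Ioo 0 Real.pi) (k : ℕ) :
    ∑ j ∈ Finset.range (k + 1), ((k.choose j : ℝ) : ℂ) *
      Complex.exp (((j : ℝ) - α * k : ℝ) *
        ((Real.log (Real.sin (α * φ) / Real.sin ((1 - α) * φ)) : ℝ) + φ * Complex.I)) =
      (((kanter α φ)⁻¹ ^ k : ℝ) : ℂ) := by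
  have a := sin_mul_pos h0 h1 hφ
  have b := sin_mul_pos (sub_pos.2 h1) (by linarith : 1 - α < 1) hφ
  have c := Real.sin_pos_of_pos_of_lt_pi hφ.1 hφ.2
  set L : ℝ := Real.log (Real.sin (α * φ) / Real.sin ((1 - α) * φ)) with hL
  set w : ℂ := (L : ℝ) + φ * Complex.I with hw
  have key : Complex.exp (-(α * w)) * (Complex.exp w + 1) = ((kanter α φ)⁻¹ : ℝ) := by
    have e1 : Complex.exp w = ((Real.sin (α * φ) / Real.sin ((1 - α) * φ) : ℝ) : ℂ) *
        Complex.exp (φ * Complex.I) := by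
      rw [hw, Complex.exp_add, ← Complex.ofReal_exp, hL, Real.exp_log (by positivity)]
    have e2 : Complex.exp (-(α * w)) = ((Real.exp (-(α * L)) : ℝ) : ℂ) *
        Complex.exp ((-(α * φ) : ℝ) * Complex.I) := by
      rw [hw, Complex.ofReal_exp, ← Complex.exp_add]
      congr 1; push_cast; ring
    have e3 : Complex.exp ((-(α * φ) : ℝ) * Complex.I) * (Complex.exp w + 1) =
        ((Real.sin φ / Real.sin ((1 - α) * φ) : ℝ) : ℂ) := by
      have hb : (Real.sin ((1 - α) * φ) : ℂ) ≠ 0 := by exact_mod_cast b.ne'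
      have e4 : Complex.exp ((-(α * φ) : ℝ) * Complex.I) * Complex.exp (φ * Complex.I) =
          Complex.exp (((1 - α) * φ : ℝ) * Complex.I) := by
        rw [← Complex.exp_add]; congr 1; push_cast; ring
      rw [e1, mul_add, mul_left_comm, e4, Complex.ofReal_div, Complex.ofReal_div, mul_one,
        Complex.exp_mul_I, Complex.exp_mul_I, ← Complex.ofReal_cos, ← Complex.ofReal_cos,
        ← Complex.ofReal_sin, ← Complex.ofReal_sin, Real.cos_neg, Real.sin_neg]
      have e5 : Real.sin φ = Real.sin (α * φ) * Real.cos ((1 - α) * φ) +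
          Real.cos (α * φ) * Real.sin ((1 - α) * φ) := by
        rw [← Real.sin_add]; congr 1; ring
      rw [e5]
      generalize Real.sin ((1 - α) * φ) = s at hb ⊢
      generalize Real.sin (α * φ) = s'
      generalize Real.cos (α * φ) = c'
      generalize Real.cos ((1 - α) * φ) = c''
      push_cast
      field_simp
      ring
    rw [e2, mul_assoc, e3, ← Complex.ofReal_mul]
    congr 1
    rw [kanter, inv_div, hL, ← mul_neg,
      ← Real.log_inv, inv_div, mul_comm α, ← Real.rpow_def_of_pos (by positivity),
      Real.div_rpow b.le a.le, Real.rpow_sub b, Real.rpow_one]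
    field_simp
  have : (((kanter α φ)⁻¹ ^ k : ℝ) : ℂ) = Complex.exp (-(α * w)) ^ k * (Complex.exp w + 1) ^ k := by
    rw [← mul_pow, key]; push_cast; rfl
  rw [this, add_pow, Finset.mul_sum]
  refine Finset.sum_congr rfl fun j _ => ?_
  have e : Complex.exp (((j : ℝ) - α * k : ℝ) * w) =
      Complex.exp (-(α * w)) ^ k * Complex.exp w ^ j := by
    rw [← Complex.exp_nat_mul, ← Complex.exp_nat_mul, ← Complex.exp_add]
    congr 1; push_cast; ring
  rw [e]
  push_cast
  ring

theorem kanter_inv_le {α φ : ℝ} (h0 : 0 < α) (h1 : α < 1) (hφ : φ ∈ Ioo 0 Real.pi) :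
    (kanter α φ)⁻¹ ≤ (α ^ α * (1 - α) ^ (1 - α))⁻¹ := by
  have c := Real.sin_pos_of_pos_of_lt_pi hφ.1 hφ.2
  have aux : ∀ l : ℝ, 0 < l → l < 1 → l * Real.sin φ ≤ Real.sin (l * φ) := by
    intro l hl hl'
    have := strictConcaveOn_sin_Icc.concaveOn.2 (x := 0) (y := φ) ⟨le_rfl, Real.pi_pos.le⟩
      ⟨hφ.1.le, hφ.2.le⟩ (sub_pos.2 hl').le hl.le (by ring)
    simpa using this
  have hb : (0 : ℝ) < 1 - α := by linarith
  have a1 := aux α h0 h1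
  have a2 := aux (1 - α) hb (by linarith)
  refine inv_anti₀ (by positivity) ?_
  rw [kanter, le_div_iff₀ c]
  calc α ^ α * (1 - α) ^ (1 - α) * Real.sin φ
      = (α * Real.sin φ) ^ α * ((1 - α) * Real.sin φ) ^ (1 - α) := by
        rw [Real.mul_rpow h0.le c.le, Real.mul_rpow hb.le c.le]
        have : Real.sin φ = Real.sin φ ^ α * Real.sin φ ^ (1 - α) := by
          rw [← Real.rpow_add c]; simp
        nth_rewrite 1 [this]
        ring
    _ ≤ _ := by
        have : 0 ≤ Real.sin (α * φ) := (by positivity : 0 ≤ α * Real.sin φ).trans a1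
        gcongr

theorem measurable_kanter (α : ℝ) : Measurable (kanter α) := by
  unfold kanter
  fun_prop

theorem integrable_kanter {α : ℝ} (h0 : 0 < α) (h1 : α < 1) (k : ℕ) :
    IntervalIntegrable (fun φ => (kanter α φ)⁻¹ ^ k) volume 0 Real.pi := by
  rw [intervalIntegrable_iff_integrableOn_Ioo_of_le Real.pi_pos.le]
  refine Measure.integrableOn_of_bounded (M := (α ^ α * (1 - α) ^ (1 - α))⁻¹ ^ k) (by simp)
    ((measurable_kanter α).inv.pow_const k).aestronglyMeasurable ?_
  refine (ae_restrict_iff' measurableSet_Ioo).2 (ae_of_all _ fun φ hφ => ?_)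
  have := (kanter_pos h0 h1 hφ).le
  rw [Real.norm_of_nonneg (by positivity)]
  exact pow_le_pow_left₀ (by positivity) (kanter_inv_le h0 h1 hφ) k

theorem integral_kanter {α : ℝ} (h0 : 0 < α) (h1 : α < 1) (k : ℕ) :
    ∫ φ in (0 : ℝ)..Real.pi, (kanter α φ)⁻¹ ^ k = Real.pi * (k.factorial *
      (Real.Gamma (1 + α * k))⁻¹ * (Real.Gamma (1 + (1 - α) * k))⁻¹) := by
  have hb : (0 : ℝ) < 1 - α := by linarith
  set L : ℝ → ℝ := fun φ => Real.log (Real.sin (α * φ) / Real.sin ((1 - α) * φ)) with hL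
  set q : ℝ → ℝ → ℝ := fun m φ => Real.exp (m * L φ) * (φ * Real.sinc (m * φ)) with hq
  set R : ℝ → ℝ := fun φ => α * Real.sinc (α * φ) / ((1 - α) * Real.sinc ((1 - α) * φ)) with hR
  have sinc_eq : ∀ l φ : ℝ, 0 < l → 0 < φ → Real.sin (l * φ) = l * Real.sinc (l * φ) * φ := by
    intro l φ hl hφ
    rw [Real.sinc_of_ne_zero (by positivity)]
    field_simp
  have hLR : ∀ φ, 0 < φ → L φ = Real.log (R φ) := by
    intro φ hφ
    simp only [hL, hR, sinc_eq _ _ h0 hφ, sinc_eq _ _ hb hφ]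
    rw [mul_div_mul_right _ _ hφ.ne']
  have hderiv : ∀ φ ∈ Ioo 0 Real.pi,
      HasDerivAt (fun φ => ∑ j ∈ Finset.range (k + 1), (k.choose j : ℝ) * q (j - α * k) φ)
        ((kanter α φ)⁻¹ ^ k) φ := by
    intro φ hφ
    have a := sin_mul_pos h0 h1 hφ
    have b := sin_mul_pos hb (by linarith : 1 - α < 1) hφ
    obtain ⟨l, hl⟩ : ∃ l, HasDerivAt L l φ := by
      have : DifferentiableAt ℝ L φ := by
        have e : Real.sin (α * φ) / Real.sin ((1 - α) * φ) ≠ 0 := by positivity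
        have e' := b.ne'
        simp only [hL]
        exact DifferentiableAt.log (DifferentiableAt.div (by fun_prop) (by fun_prop) e') e
      exact ⟨_, this.hasDerivAt⟩
    have hqd : ∀ m : ℝ, HasDerivAt (q m)
        (Complex.exp ((m : ℝ) * ((L φ : ℝ) + φ * Complex.I)) * (l + Complex.I)).im φ := by
      intro m
      have e : (Complex.exp ((m : ℝ) * ((L φ : ℝ) + φ * Complex.I)) * (l + Complex.I)).im =
          Real.exp (m * L φ) * (l * Real.sin (m * φ) + Real.cos (m * φ)) := by
        rw [Complex.mul_im, Complex.exp_re, Complex.exp_im]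
        simp
        ring
      rw [e]
      rcases eq_or_ne m 0 with rfl | hm
      · simpa [hq] using hasDerivAt_id' φ
      · have e2 : q m = fun φ => Real.exp (m * L φ) * (Real.sin (m * φ) / m) := by
          funext x
          simp only [hq]
          rcases eq_or_ne x 0 with rfl | hx
          · simp
          · rw [Real.sinc_of_ne_zero (by positivity)]
            field_simp
        rw [e2]
        have d1 := (hl.const_mul m).exp
        have d2 := (((hasDerivAt_id' φ).const_mul m).sin).div_const m
        refine (d1.mul d2).congr_deriv ?_
        field_simp
    have hs := HasDerivAt.fun_sum (u := Finset.range (k + 1))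
      (fun j _ => (hqd (j - α * k)).const_mul (k.choose j : ℝ))
    refine hs.congr_deriv ?_
    have lc := congrArg (fun z : ℂ => (z * (l + Complex.I)).im) (level_curve h0 h1 hφ k)
    simp only [Finset.sum_mul, Complex.im_sum] at lc
    rw [Complex.im_ofReal_mul] at lc
    simp only [mul_assoc, Complex.im_ofReal_mul] at lc
    simpa using lc
  have hRc : ∀ φ ∈ Icc 0 Real.pi, 0 < R φ ∧ ContinuousAt R φ := by
    intro φ hφ
    have pos : ∀ l : ℝ, 0 < l → l < 1 → 0 < Real.sinc (l * φ) := by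
      intro l hl hl'
      rcases hφ.1.eq_or_lt with h | h
      · simp [← h]
      · rw [Real.sinc_of_ne_zero (by positivity)]
        exact div_pos (Real.sin_pos_of_pos_of_lt_pi (by positivity)
          (by nlinarith [hφ.2])) (by positivity)
    have p1 := pos α h0 h1
    have p2 := pos (1 - α) hb (by linarith)
    refine ⟨by simp only [hR]; positivity, ?_⟩
    simp only [hR]
    refine ContinuousAt.div ?_ ?_ (by positivity)
    · have := Real.continuous_sinc; fun_prop
    · have := Real.continuous_sinc; fun_prop
  have hqlim : ∀ φ ∈ Icc 0 Real.pi, Tendsto (fun x => ∑ j ∈ Finset.range (k + 1),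
      (k.choose j : ℝ) * q (j - α * k) x) (𝓟 (Ioi 0) ⊓ 𝓝 φ) (𝓝 (∑ j ∈ Finset.range (k + 1),
      (k.choose j : ℝ) * (Real.exp ((j - α * k) * Real.log (R φ)) *
        (φ * Real.sinc ((j - α * k) * φ))))) := by
    intro φ hφ
    have c : ContinuousAt (fun x => ∑ j ∈ Finset.range (k + 1),
      (k.choose j : ℝ) * (Real.exp ((j - α * k) * Real.log (R x)) *
        (x * Real.sinc ((j - α * k) * x)))) φ := by
      have := Real.continuous_sinc
      have h' := (hRc φ hφ).2
      have h'' := (hRc φ hφ).1.ne'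
      fun_prop (disch := assumption)
    refine (c.tendsto.mono_left inf_le_right).congr' ?_
    refine Filter.Eventually.filter_mono inf_le_left ?_
    refine eventually_principal.2 fun x hx => ?_
    simp only [hq, hLR x hx]
  have hRpi : R Real.pi = 1 := by
    have p := Real.pi_pos
    have s0 := sinc_eq _ _ h0 p
    have s1 := sinc_eq _ _ hb p
    have s2 : Real.sin ((1 - α) * Real.pi) = Real.sin (α * Real.pi) := by
      rw [← Real.sin_pi_sub]; congr 1; ring
    have s3 : α * Real.sinc (α * Real.pi) = (1 - α) * Real.sinc ((1 - α) * Real.pi) :=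
      mul_right_cancel₀ p.ne' (by rw [← s0, ← s1, s2])
    have s4 : 0 < Real.sin (α * Real.pi) :=
      Real.sin_pos_of_pos_of_lt_pi (by positivity) (by nlinarith)
    simp only [hR]
    rw [s3, div_self]
    intro h
    rw [s0, s3, h] at s4
    simp at s4
  have t0 := hqlim 0 ⟨le_rfl, Real.pi_pos.le⟩
  have t1 := hqlim Real.pi ⟨Real.pi_pos.le, le_rfl⟩
  rw [inf_comm] at t0
  have t1' := t1.mono_left (le_inf (le_principal_iff.2
    (mem_nhdsWithin_of_mem_nhds (Ioi_mem_nhds Real.pi_pos))) nhdsWithin_le_nhds :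
    𝓝[<] Real.pi ≤ _)
  rw [intervalIntegral.integral_eq_sub_of_hasDerivAt_of_tendsto Real.pi_pos hderiv
    (integrable_kanter h0 h1 k) t0 t1']
  have h := sum_choose_sinc k (α * k)
  rw [show (1 : ℝ) + k - α * k = 1 + (1 - α) * k by ring] at h
  rw [← h, hRpi, Finset.mul_sum]
  simp only [Real.log_one, mul_zero, Real.exp_zero, one_mul, zero_mul, Finset.sum_const_zero,
    sub_zero]
  refine Finset.sum_congr rfl fun j _ => ?_
  rw [mul_comm (_ - _) Real.pi]
  ring

/-- The probability density `h_α` on `(0, ∞)` (the M-Wright function). It is the density of `S ^ (-α)`, where `S`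
is the one-sided `α`-stable variable with Laplace transform `exp (-s ^ α)`, in its Kanter--Zolotarev integral
representation. The lemmas below show that it is the function determined by the two usual properties:
its moments are `∫ θ ^ k h_α(θ) dθ = k! / Γ(1 + α k)` (in particular its mass is `1`), and
`∫ h_α(θ) e ^ (z θ) dθ = E_{α,1}(z)` for all complex `z` (`wrightDensity_laplace`). -/
noncomputable def wrightDensity (α θ : ℝ) : ℝ :=
  Real.pi⁻¹ * ∫ φ in (0 : ℝ)..Real.pi, (1 - α)⁻¹ * kanter α φ ^ (1 - α)⁻¹ *
    θ ^ (α / (1 - α)) * Real.exp (-(θ * kanter α φ) ^ (1 - α)⁻¹)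

theorem wright_kernel_moment {α b : ℝ} (h0 : 0 < α) (h1 : α < 1) (hb : 0 < b) (k : ℕ) :
    IntegrableOn (fun θ : ℝ => θ ^ k * ((1 - α)⁻¹ * b ^ (1 - α)⁻¹ * θ ^ (α / (1 - α)) *
      Real.exp (-(θ * b) ^ (1 - α)⁻¹))) (Ioi 0) ∧
    ∫ θ in Ioi (0 : ℝ), θ ^ k * ((1 - α)⁻¹ * b ^ (1 - α)⁻¹ * θ ^ (α / (1 - α)) *
      Real.exp (-(θ * b) ^ (1 - α)⁻¹)) = b⁻¹ ^ k * Real.Gamma (1 + (1 - α) * k) := by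
  have hc : (0 : ℝ) < 1 - α := by linarith
  have hcp : (0 : ℝ) < (1 - α)⁻¹ := by positivity
  have e : EqOn (fun θ : ℝ => θ ^ k * ((1 - α)⁻¹ * b ^ (1 - α)⁻¹ * θ ^ (α / (1 - α)) *
      Real.exp (-(θ * b) ^ (1 - α)⁻¹))) (fun θ => ((1 - α)⁻¹ * b ^ (1 - α)⁻¹) *
      (θ ^ (k + α / (1 - α)) * Real.exp (-(b ^ (1 - α)⁻¹) * θ ^ (1 - α)⁻¹))) (Ioi 0) := by
    intro θ hθ
    have hθ : 0 < θ := hθ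
    simp only
    rw [Real.rpow_add hθ, Real.rpow_natCast, Real.mul_rpow hθ.le hb.le]
    ring_nf
  have hq : -1 < (k : ℝ) + α / (1 - α) := by
    have : 0 < α / (1 - α) := by positivity
    have := k.cast_nonneg (α := ℝ)
    linarith
  constructor
  · rw [integrableOn_congr_fun e measurableSet_Ioi]
    refine Integrable.const_mul ?_ _
    exact integrableOn_rpow_mul_exp_neg_mul_rpow hq hcp (by positivity)
  · rw [setIntegral_congr_fun measurableSet_Ioi e, integral_const_mul,
      integral_rpow_mul_exp_neg_mul_rpow hcp hq (by positivity), ← Real.rpow_mul hb.le]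
    have e1 : ((k : ℝ) + α / (1 - α) + 1) / (1 - α)⁻¹ = 1 + (1 - α) * k := by
      field_simp; ring
    have e2 : (1 - α)⁻¹ * (-((k : ℝ) + α / (1 - α) + 1) / (1 - α)⁻¹) = -(1 - α)⁻¹ + -(k : ℝ) := by
      field_simp; ring
    rw [e1, e2, Real.rpow_add hb, Real.rpow_neg hb.le, Real.rpow_neg hb.le, Real.rpow_natCast]
    have : 0 < b ^ (1 - α)⁻¹ := by positivity
    rw [inv_pow]
    field_simp

theorem wright_integrand_measurable (α : ℝ) : Measurable (fun x : ℝ × ℝ =>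
    (1 - α)⁻¹ * kanter α x.2 ^ (1 - α)⁻¹ * x.1 ^ (α / (1 - α)) *
      Real.exp (-(x.1 * kanter α x.2) ^ (1 - α)⁻¹)) := by
  have := measurable_kanter α
  fun_prop

theorem measurable_wrightDensity (α : ℝ) : Measurable (wrightDensity α) := by
  unfold wrightDensity
  refine Measurable.const_mul ?_ _
  simp only [intervalIntegral.integral_of_le Real.pi_pos.le]
  exact (wright_integrand_measurable α).stronglyMeasurable.integral_prod_right'.measurable

theorem wrightDensity_nonneg {α θ : ℝ} (h0 : 0 < α) (h1 : α < 1) (hθ : 0 < θ) :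
    0 ≤ wrightDensity α θ := by
  have hc : (0 : ℝ) < 1 - α := by linarith
  unfold wrightDensity
  rw [intervalIntegral.integral_of_le Real.pi_pos.le, integral_Ioc_eq_integral_Ioo]
  refine mul_nonneg (by positivity) (setIntegral_nonneg measurableSet_Ioo fun φ hφ => ?_)
  have := kanter_pos h0 h1 hφ
  positivity

theorem wrightDensity_moment {α : ℝ} (h0 : 0 < α) (h1 : α < 1) (k : ℕ) :
    IntegrableOn (fun θ => θ ^ k * wrightDensity α θ) (Ioi 0) ∧
    ∫ θ in Ioi (0 : ℝ), θ ^ k * wrightDensity α θ = k.factorial / Real.Gamma (1 + α * k) := by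
  have hc : (0 : ℝ) < 1 - α := by linarith
  set F : ℝ × ℝ → ℝ := fun x => x.1 ^ k * ((1 - α)⁻¹ * kanter α x.2 ^ (1 - α)⁻¹ *
    x.1 ^ (α / (1 - α)) * Real.exp (-(x.1 * kanter α x.2) ^ (1 - α)⁻¹)) with hF
  have hFm : Measurable F := (measurable_fst.pow_const k).mul (wright_integrand_measurable α)
  have hpt : ∀ θ, θ ^ k * wrightDensity α θ = Real.pi⁻¹ * ∫ φ in Ioo 0 Real.pi, F (θ, φ) := by
    intro θ
    rw [wrightDensity, intervalIntegral.integral_of_le Real.pi_pos.le,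
      integral_Ioc_eq_integral_Ioo, mul_left_comm, ← integral_const_mul]
  have hsec : ∀ φ ∈ Ioo 0 Real.pi, IntegrableOn (fun θ => F (θ, φ)) (Ioi 0) ∧
      ∫ θ in Ioi 0, F (θ, φ) = (kanter α φ)⁻¹ ^ k * Real.Gamma (1 + (1 - α) * k) :=
    fun φ hφ => wright_kernel_moment h0 h1 (kanter_pos h0 h1 hφ) k
  have hnn : ∀ φ ∈ Ioo 0 Real.pi, ∀ θ ∈ Ioi (0 : ℝ), ‖F (θ, φ)‖ = F (θ, φ) := by
    intro φ hφ θ hθ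
    have := kanter_pos h0 h1 hφ
    have hθ : 0 < θ := hθ
    refine Real.norm_of_nonneg ?_
    simp only [hF]
    positivity
  have hI : IntegrableOn (fun φ => (kanter α φ)⁻¹ ^ k * Real.Gamma (1 + (1 - α) * k))
      (Ioo 0 Real.pi) :=
    Integrable.mul_const ((intervalIntegrable_iff_integrableOn_Ioo_of_le Real.pi_pos.le).1
      (integrable_kanter h0 h1 k)) _
  have hint : Integrable F ((volume.restrict (Ioi 0)).prod (volume.restrict (Ioo 0 Real.pi))) := by
    rw [integrable_prod_iff' hFm.aestronglyMeasurable]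
    constructor
    · exact (ae_restrict_iff' measurableSet_Ioo).2 (ae_of_all _ fun φ hφ => (hsec φ hφ).1)
    · refine (integrableOn_congr_fun (fun φ hφ => ?_) measurableSet_Ioo).2 hI
      rw [setIntegral_congr_fun measurableSet_Ioi (hnn φ hφ), (hsec φ hφ).2]
  simp only [hpt]
  refine ⟨hint.integral_prod_left.const_mul _, ?_⟩
  rw [integral_const_mul, integral_integral_swap (f := fun θ φ => F (θ, φ)) hint,
    setIntegral_congr_fun measurableSet_Ioo fun φ hφ => (hsec φ hφ).2, integral_mul_const,
    ← integral_Ioc_eq_integral_Ioo, ← intervalIntegral.integral_of_le Real.pi_pos.le,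
    integral_kanter h0 h1]
  have g : 0 < Real.Gamma (1 + (1 - α) * k) := Real.Gamma_pos_of_pos (by positivity)
  have := Real.pi_ne_zero
  field_simp

/-- The Mittag-Leffler function `E_{α,β}`. -/
noncomputable def mittagLeffler (α β : ℝ) (z : ℂ) : ℂ :=
  ∑' k : ℕ, z ^ k / (Real.Gamma (α * k + β) : ℂ)

theorem summable_mittagLeffler {α : ℝ} (h0 : 0 < α) {r : ℝ} (hr : 0 ≤ r) :
    Summable fun k : ℕ => r ^ k / Real.Gamma (1 + α * k) := by
  set R : ℝ := (2 * r + 1) ^ α⁻¹ with hR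
  have hR0 : 0 < R := by positivity
  have hRα : R ^ α = 2 * r + 1 := by
    rw [hR, ← Real.rpow_mul (by positivity), inv_mul_cancel₀ h0.ne', Real.rpow_one]
  have hlow : ∀ k : ℕ, (2 * r + 1) ^ k * Real.exp (-R) ≤ Real.Gamma (1 + α * k) := by
    intro k
    rw [Real.Gamma_eq_integral (by positivity), ← hRα, ← Real.rpow_mul_natCast hR0.le]
    have hi := Real.GammaIntegral_convergent (s := 1 + α * k) (by positivity)
    calc R ^ (α * k) * Real.exp (-R) = ∫ x in Ioi R, R ^ (α * k) * Real.exp (-x) := by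
          rw [integral_const_mul, integral_exp_neg_Ioi]
      _ ≤ ∫ x in Ioi R, Real.exp (-x) * x ^ (1 + α * k - 1) := by
          refine setIntegral_mono_on ?_ (hi.mono_set (Ioi_subset_Ioi hR0.le)) measurableSet_Ioi ?_
          · exact (integrableOn_exp_neg_Ioi R).const_mul _
          · intro x hx
            rw [mul_comm, add_sub_cancel_left]
            gcongr
            exact le_of_lt hx
      _ ≤ _ := by
          refine setIntegral_mono_set hi ?_ (Ioi_subset_Ioi hR0.le).eventuallyLE
          refine (ae_restrict_iff' measurableSet_Ioi).2 (ae_of_all _ fun x hx => ?_)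
          have : 0 < x := hx
          simp only [Pi.zero_apply]
          positivity
  refine Summable.of_nonneg_of_le (f := fun k : ℕ => Real.exp R * (r / (2 * r + 1)) ^ k) ?_ ?_ ?_
  · intro k
    have : 0 < Real.Gamma (1 + α * k) := Real.Gamma_pos_of_pos (by positivity)
    positivity
  · intro k
    have : 0 < Real.Gamma (1 + α * k) := Real.Gamma_pos_of_pos (by positivity)
    have h := hlow k
    rw [Real.exp_neg] at h
    have e := Real.exp_pos R
    rw [div_pow, div_le_iff₀ this]
    calc r ^ k = Real.exp R * (r ^ k / (2 * r + 1) ^ k) *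
          ((2 * r + 1) ^ k * (Real.exp R)⁻¹) := by field_simp
      _ ≤ _ := by gcongr
  · refine (summable_geometric_of_lt_one (by positivity) ?_).mul_left _
    rw [div_lt_one (by positivity)]
    linarith

theorem wrightDensity_laplace {α : ℝ} (h0 : 0 < α) (h1 : α < 1) (z : ℂ) :
    ∫ θ in Ioi (0 : ℝ), (wrightDensity α θ : ℂ) * Complex.exp (z * θ) = mittagLeffler α 1 z := by
  set F : ℕ → ℝ → ℂ := fun k θ => (z ^ k / k.factorial) * ((θ ^ k * wrightDensity α θ : ℝ) : ℂ)
    with hF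
  have hFi : ∀ k, Integrable (F k) (volume.restrict (Ioi 0)) := fun k =>
    ((wrightDensity_moment h0 h1 k).1.ofReal).const_mul _
  have hFn : ∀ k, ∫ θ in Ioi (0 : ℝ), ‖F k θ‖ = ‖z‖ ^ k / Real.Gamma (1 + α * k) := by
    intro k
    have : EqOn (fun θ => ‖F k θ‖) (fun θ => ‖z‖ ^ k / k.factorial * (θ ^ k * wrightDensity α θ))
        (Ioi 0) := by
      intro θ hθ
      have hθ : 0 < θ := hθ
      have := wrightDensity_nonneg h0 h1 hθ
      simp only [hF, norm_mul, norm_div, norm_pow, Complex.norm_real, Complex.norm_natCast]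
      rw [Real.norm_of_nonneg hθ.le, Real.norm_of_nonneg this]
    rw [setIntegral_congr_fun measurableSet_Ioi this, integral_const_mul,
      (wrightDensity_moment h0 h1 k).2]
    field_simp
  have hs := hasSum_integral_of_summable_integral_norm hFi
    (by simpa only [hFn] using summable_mittagLeffler h0 (norm_nonneg z))
  have hexp : ∀ θ : ℝ, ∑' k, F k θ = (wrightDensity α θ : ℂ) * Complex.exp (z * θ) := by
    intro θ
    have h := NormedSpace.expSeries_div_hasSum_exp (𝔸 := ℂ) (z * θ)
    rw [← Complex.exp_eq_exp_ℂ] at h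
    rw [← (h.mul_left (wrightDensity α θ : ℂ)).tsum_eq]
    refine tsum_congr fun k => ?_
    simp only [hF]
    push_cast
    ring
  simp only [hexp] at hs
  rw [← hs.tsum_eq, mittagLeffler]
  refine tsum_congr fun k => ?_
  simp only [hF]
  rw [integral_const_mul, integral_complex_ofReal, (wrightDensity_moment h0 h1 k).2]
  have : (k.factorial : ℂ) ≠ 0 := by exact_mod_cast k.factorial_ne_zero
  push_cast
  rw [add_comm (1 : ℝ)]
  field_simp

/-- The Fujita exponent `1 + 2 / N`. -/
noncomputable def fujitaExponent (N : ℕ) : ℝ := 1 + 2 / (N : ℝ)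

/-- The Gauss kernel `G(t, x)` on `ℝ^N`. -/
noncomputable def heatKernel {N : ℕ} (t : ℝ) (x : EuclideanSpace ℝ (Fin N)) : ℝ :=
  1 / (4 * Real.pi * t) ^ ((N : ℝ) / 2) * Real.exp (-‖x‖ ^ 2 / (4 * t))

/-- `(e^{tΔ} μ)(x)` for a nonnegative measure `μ`, with values in `[0, ∞]`. -/
noncomputable def heatSemigroup {N : ℕ} (t : ℝ) (μ : Measure (EuclideanSpace ℝ (Fin N)))
    (x : EuclideanSpace ℝ (Fin N)) : ℝ≥0∞ :=
  ∫⁻ y, ENNReal.ofReal (heatKernel t (x - y)) ∂μ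

/-- `(P_α(t) μ)(x) = ∫_0^∞ h_α(θ) (e^{t^α θ Δ} μ)(x) dθ`. -/
noncomputable def opP {N : ℕ} (α t : ℝ) (μ : Measure (EuclideanSpace ℝ (Fin N)))
    (x : EuclideanSpace ℝ (Fin N)) : ℝ≥0∞ :=
  ∫⁻ θ in Ioi (0 : ℝ), ENNReal.ofReal (wrightDensity α θ) * heatSemigroup (t ^ α * θ) μ x

/-- `(S_α(t) μ)(x) = ∫_0^∞ θ h_α(θ) (e^{t^α θ Δ} μ)(x) dθ`. -/
noncomputable def opS {N : ℕ} (α t : ℝ) (μ : Measure (EuclideanSpace ℝ (Fin N)))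
    (x : EuclideanSpace ℝ (Fin N)) : ℝ≥0∞ :=
  ∫⁻ θ in Ioi (0 : ℝ), ENNReal.ofReal (θ * wrightDensity α θ) * heatSemigroup (t ^ α * θ) μ x

/-- `u` is a nonnegative solution on `[0, T] × ℝ^N` of `∂_t^α u - Δ u = u ^ p`, `u(0) = μ`: it is measurable on
`(0, T] × ℝ^N`, and for almost all `(t, x)` it is finite and satisfies
`u(t) = P_α(t) μ + α ∫_0^t (t - s) ^ (α - 1) S_α(t - s) (u(s) ^ p) ds`, where the function `u(s) ^ p` is
identified with the measure `u(s) ^ p dx`. The values of `u` for `t ∉ (0, T]` are irrelevant. -/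
structure IsSolution {N : ℕ} (α p T : ℝ) (μ : Measure (EuclideanSpace ℝ (Fin N)))
    (u : ℝ → EuclideanSpace ℝ (Fin N) → ℝ≥0∞) : Prop where
  measurable : Measurable fun q : Ioc (0 : ℝ) T × EuclideanSpace ℝ (Fin N) => u q.1 q.2
  equation : ∀ᵐ q : ℝ × EuclideanSpace ℝ (Fin N) ∂((volume.restrict (Ioc 0 T)).prod volume),
    u q.1 q.2 < ∞ ∧
    u q.1 q.2 = opP α q.1 μ q.2 + ENNReal.ofReal α *
      ∫⁻ s in Ioo 0 q.1, ENNReal.ofReal ((q.1 - s) ^ (α - 1)) *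
        opS α (q.1 - s) (volume.withDensity fun y => u s y ^ p) q.2

end TimeFractional

/-!
Average the `L^1`-`L^p` smoothing estimate of the heat semigroup in uniformly local spaces over the
M-Wright density: with `β = N / 2 * (1 - 1 / p)`, both `P_α(t)` and `S_α(t)` send measures of finite
uniformly local mass to `L^p_uloc` with norm at most `C t ^ (-α β)`, where `C` does not depend on
`α` because the moments `∫ h_α` and `∫ θ ^ (-β) h_α` (here `β < 1`) are bounded uniformly in `α`.
If `‖u(s)‖ ≤ K s ^ (-α β)`, the mass of `u(s) ^ p` is at most `K ^ p s ^ (-α β p)`, and the Duhamel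
term is controlled by a Beta integral, which costs a single factor `1 / (1 - α β p)` with
`β p = N (p - 1) / 2 ≤ 1`. Hence the Picard iterates, which increase, stay in a ball as soon as
`K ^ (p - 1)` is a small multiple of `1 - α β p`, and their supremum is the solution. The threshold
is therefore `c (1 - α β p) ^ (1 / (p - 1))`: nonzero at `α = 1` for `p < p_F`, and equal to
`c (1 - α) ^ (N / 2)` for `p = p_F`.
-/

namespace TimeFractional

open scoped NNReal

section MinkowskiIntegral

variable {X A : Type*} [MeasurableSpace X] [MeasurableSpace A] {ν : Measure X} {κ : Measure A}
  {p : ℝ}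

theorem lintegral_rpow_le_lintegral_rpow_mul_weight (hp : 1 < p) {g c : A → ℝ≥0∞}
    (hg : AEMeasurable g κ) (hc : AEMeasurable c κ) (hcT : ∀ᵐ a ∂κ, c a ≠ ∞)
    (hgc : ∀ᵐ a ∂κ, c a = 0 → g a = 0) :
    (∫⁻ a, g a ∂κ) ^ p ≤ (∫⁻ a, g a ^ p * c a ^ (1 - p) ∂κ) * (∫⁻ a, c a ∂κ) ^ (p - 1) := by
  have hpq := Real.HolderConjugate.conjExponent hp
  set q := p.conjExponent
  have hp0 : 0 < p := hpq.pos
  have hpq' : 1 / q * p = p - 1 := by rw [one_div_mul_eq_div, hpq.div_conj_eq_sub_one]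
  have hsplit : ∫⁻ a, g a ∂κ =
      ∫⁻ a, g a * c a ^ (-(1 / q)) * c a ^ (1 / q) ∂κ := by
    refine lintegral_congr_ae ?_
    filter_upwards [hcT, hgc] with a hT h0
    rcases eq_or_ne (c a) 0 with hca | hca
    · simp [h0 hca]
    · rw [mul_assoc, ← ENNReal.rpow_add _ _ hca hT, neg_add_cancel, ENNReal.rpow_zero, mul_one]
  have hfst (a : A) : (g a * c a ^ (-(1 / q))) ^ p = g a ^ p * c a ^ (1 - p) := by
    rw [ENNReal.mul_rpow_of_nonneg _ _ hp0.le, ← ENNReal.rpow_mul, neg_mul, hpq', neg_sub]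
  have hsnd (a : A) : (c a ^ (1 / q)) ^ q = c a := by
    rw [← ENNReal.rpow_mul, one_div_mul_cancel hpq.symm.ne_zero, ENNReal.rpow_one]
  have hölder := ENNReal.lintegral_mul_le_Lp_mul_Lq κ hpq
    (f := fun a => g a * c a ^ (-(1 / q))) (g := fun a => c a ^ (1 / q))
    (hg.mul (hc.pow_const _)) (hc.pow_const _)
  simp only [Pi.mul_apply, hfst, hsnd, ← hsplit] at hölder
  calc (∫⁻ a, g a ∂κ) ^ p
      ≤ ((∫⁻ a, g a ^ p * c a ^ (1 - p) ∂κ) ^ (1 / p) * (∫⁻ a, c a ∂κ) ^ (1 / q)) ^ p := by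
        gcongr
    _ = _ := by
        rw [ENNReal.mul_rpow_of_nonneg _ _ hp0.le, ← ENNReal.rpow_mul, ← ENNReal.rpow_mul,
          one_div_mul_cancel hp0.ne', ENNReal.rpow_one, hpq']

variable [SFinite ν] [SFinite κ]

theorem ae_ae_eq_zero_of_lintegral_rpow_eq_zero (hp : 0 < p) {f : A → X → ℝ≥0∞}
    (hf : Measurable (Function.uncurry f)) :
    ∀ᵐ x ∂ν, ∀ᵐ a ∂κ, ∫⁻ y, f a y ^ p ∂ν = 0 → f a x = 0 := by
  rw [← Measure.ae_ae_comm (.imp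
    ((hf.pow_const p).lintegral_prod_right'.comp measurable_fst (measurableSet_singleton 0))
    (hf (measurableSet_singleton 0)))]
  refine .of_forall fun a => ?_
  by_cases hfa : ∫⁻ y, f a y ^ p ∂ν = 0
  · filter_upwards [(lintegral_eq_zero_iff ((hf.comp measurable_prodMk_left).pow_const p)).1 hfa]
      with x hx _ using (ENNReal.rpow_eq_zero_iff_of_pos hp).1 hx
  · simp [hfa]

theorem lintegral_Lp_lintegral_le (hp : 1 ≤ p) {f : A → X → ℝ≥0∞}
    (hf : Measurable (Function.uncurry f)) :
    (∫⁻ x, (∫⁻ a, f a x ∂κ) ^ p ∂ν) ^ (1 / p) ≤ ∫⁻ a, (∫⁻ x, f a x ^ p ∂ν) ^ (1 / p) ∂κ := by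
  rcases hp.eq_or_lt with rfl | hp
  · simpa using (lintegral_lintegral_swap hf.aemeasurable).ge
  have hp0 : 0 < p := one_pos.trans hp
  have hfx (x : X) : Measurable fun a => f a x := hf.comp measurable_prodMk_right
  have hfa (a : A) : Measurable (f a) := hf.comp measurable_prodMk_left
  set c : A → ℝ≥0∞ := fun a => (∫⁻ x, f a x ^ p ∂ν) ^ (1 / p) with hc_def
  have hc : Measurable c := (hf.pow_const p).lintegral_prod_right'.pow_const _
  have hcp (a : A) : ∫⁻ x, f a x ^ p ∂ν = c a ^ p := by
    rw [hc_def, ← ENNReal.rpow_mul, one_div_mul_cancel hp0.ne', ENNReal.rpow_one]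
  by_cases hfin : ∫⁻ a, c a ∂κ = ∞
  · exact hfin ▸ le_top
  have hcT : ∀ᵐ a ∂κ, c a ≠ ∞ := (ae_lt_top hc hfin).mono fun _ => ne_top_of_lt
  have hzero : ∀ᵐ x ∂ν, ∀ᵐ a ∂κ, c a = 0 → f a x = 0 := by
    filter_upwards [ae_ae_eq_zero_of_lintegral_rpow_eq_zero (ν := ν) (κ := κ) hp0 hf] with x hx
    filter_upwards [hx] with a ha hca using ha (by rw [hcp, hca, ENNReal.zero_rpow_of_pos hp0])
  have hweight : Measurable (Function.uncurry fun x a => f a x ^ p * c a ^ (1 - p)) :=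
    ((hf.comp measurable_swap).pow_const p).mul ((hc.comp measurable_snd).pow_const _)
  rw [one_div, ENNReal.rpow_inv_le_iff hp0]
  calc ∫⁻ x, (∫⁻ a, f a x ∂κ) ^ p ∂ν
      ≤ ∫⁻ x, (∫⁻ a, f a x ^ p * c a ^ (1 - p) ∂κ) * (∫⁻ a, c a ∂κ) ^ (p - 1) ∂ν :=
        lintegral_mono_ae <| hzero.mono fun x hx =>
          lintegral_rpow_le_lintegral_rpow_mul_weight hp (hfx x).aemeasurable hc.aemeasurable hcT hx
    _ = (∫⁻ a, c a ^ p * c a ^ (1 - p) ∂κ) * (∫⁻ a, c a ∂κ) ^ (p - 1) := by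
        rw [lintegral_mul_const _ (by exact hweight.lintegral_prod_right'),
          lintegral_lintegral_swap hweight.aemeasurable]
        simp_rw [lintegral_mul_const _ ((hfa _).pow_const p), hcp]
    _ ≤ (∫⁻ a, c a ∂κ) * (∫⁻ a, c a ∂κ) ^ (p - 1) := by
        gcongr ?_ * _
        refine lintegral_mono_ae <| hcT.mono fun a hT => ?_
        rcases eq_or_ne (c a) 0 with hca | hca
        · simp [hca, hp0]
        · rw [← ENNReal.rpow_add _ _ hca hT, add_sub_cancel, ENNReal.rpow_one]
    _ = (∫⁻ a, c a ∂κ) ^ p := by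
        nth_rw 1 [← ENNReal.rpow_one (∫⁻ a, c a ∂κ)]
        rw [← ENNReal.rpow_add_of_nonneg _ _ zero_le_one (by linarith), add_sub_cancel]

end MinkowskiIntegral

section PowerIntegrals

variable {t a b : ℝ}

theorem lintegral_rpow_Ioo (ht : 0 < t) (ha : -1 < a) :
    ∫⁻ s in Ioo 0 t, ENNReal.ofReal (s ^ a) = ENNReal.ofReal (t ^ (a + 1) / (a + 1)) := by
  have hint : IntegrableOn (fun s : ℝ => s ^ a) (Ioo 0 t) :=
    (intervalIntegrable_iff_integrableOn_Ioo_of_le ht.le).1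
      (intervalIntegral.intervalIntegrable_rpow' ha)
  have hnonneg : 0 ≤ᵐ[volume.restrict (Ioo 0 t)] fun s => s ^ a :=
    ae_restrict_of_forall_mem measurableSet_Ioo fun s hs => Real.rpow_nonneg hs.1.le _
  rw [← ofReal_integral_eq_lintegral_ofReal hint hnonneg, ← integral_Ioc_eq_integral_Ioo,
    ← intervalIntegral.integral_of_le ht.le, integral_rpow (.inl ha),
    Real.zero_rpow (by linarith), sub_zero]

theorem lintegral_sub_rpow_Ioo (ht : 0 < t) (ha : -1 < a) :
    ∫⁻ s in Ioo 0 t, ENNReal.ofReal ((t - s) ^ a) = ENNReal.ofReal (t ^ (a + 1) / (a + 1)) := by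
  rw [← lintegral_rpow_Ioo ht ha, ← lintegral_indicator measurableSet_Ioo,
    ← lintegral_indicator measurableSet_Ioo,
    ← lintegral_sub_left_eq_self (indicator (Ioo 0 t) fun s => ENNReal.ofReal (s ^ a)) t]
  refine lintegral_congr fun s => ?_
  have hmem : s ∈ Ioo 0 t ↔ t - s ∈ Ioo 0 t := by simp [and_comm]
  by_cases hs : s ∈ Ioo 0 t
  · rw [indicator_of_mem hs, indicator_of_mem (hmem.1 hs)]
  · rw [indicator_of_notMem hs, indicator_of_notMem (hmem.not.1 hs)]

theorem lintegral_sub_rpow_mul_rpow_le (ht : 0 < t) (ha : -1 < a) (hb : -1 < b) :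
    ∫⁻ s in Ioo 0 t, ENNReal.ofReal ((t - s) ^ a * s ^ b) ≤
      ENNReal.ofReal (t ^ (a + b + 1) * (1 / (a + 1) + 1 / (b + 1))) := by
  have ha1 : 0 < a + 1 := by linarith
  have hb1 : 0 < b + 1 := by linarith
  -- split `1 = (s + (t - s)) / t` and estimate each of the two positive powers by its value at `t`
  have hpt : ∀ s ∈ Ioo 0 t, ENNReal.ofReal ((t - s) ^ a * s ^ b) ≤
      ENNReal.ofReal (t ^ a) * ENNReal.ofReal (s ^ b) +
        ENNReal.ofReal (t ^ b) * ENNReal.ofReal ((t - s) ^ a) := by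
    rintro s ⟨hs, hst⟩
    have hts : 0 < t - s := sub_pos.2 hst
    rw [← ENNReal.ofReal_mul (by positivity), ← ENNReal.ofReal_mul (by positivity),
      ← ENNReal.ofReal_add (by positivity) (by positivity)]
    refine ENNReal.ofReal_le_ofReal (le_of_mul_le_mul_left ?_ ht)
    calc t * ((t - s) ^ a * s ^ b) = (t - s) ^ (a + 1) * s ^ b + s ^ (b + 1) * (t - s) ^ a := by
          rw [Real.rpow_add_one hts.ne', Real.rpow_add_one hs.ne']
          ring
      _ ≤ t ^ (a + 1) * s ^ b + t ^ (b + 1) * (t - s) ^ a := by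
          gcongr
          linarith
      _ = t * (t ^ a * s ^ b + t ^ b * (t - s) ^ a) := by
          rw [Real.rpow_add_one ht.ne', Real.rpow_add_one ht.ne']
          ring
  refine (setLIntegral_mono (by fun_prop) hpt).trans_eq ?_
  rw [lintegral_add_left (by fun_prop), lintegral_const_mul _ (by fun_prop),
    lintegral_const_mul _ (by fun_prop), lintegral_rpow_Ioo ht hb, lintegral_sub_rpow_Ioo ht ha,
    ← ENNReal.ofReal_mul (by positivity), ← ENNReal.ofReal_mul (by positivity),
    ← ENNReal.ofReal_add (by positivity) (by positivity), Real.rpow_add_one ht.ne',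
    Real.rpow_add_one ht.ne', Real.rpow_add_one ht.ne', Real.rpow_add ht]
  congr 1
  ring

theorem lintegral_sin_rpow_neg_lt_top {β : ℝ} (h0 : 0 ≤ β) (h1 : β < 1) :
    ∫⁻ φ in Ioo 0 Real.pi, ENNReal.ofReal (Real.sin φ ^ (-β)) < ∞ := by
  have hπ := Real.pi_pos
  have hjordan (φ : ℝ) (hφ : 0 < φ) (hφ' : φ ≤ Real.pi / 2) :
      ENNReal.ofReal (Real.sin φ ^ (-β)) ≤
        ENNReal.ofReal ((2 / Real.pi) ^ (-β)) * ENNReal.ofReal (φ ^ (-β)) := by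
    rw [← ENNReal.ofReal_mul (by positivity), ← Real.mul_rpow (by positivity) hφ.le]
    exact ENNReal.ofReal_le_ofReal <|
      Real.rpow_le_rpow_of_nonpos (by positivity) (Real.mul_le_sin hφ.le hφ') (by linarith)
  have hpt : ∀ φ ∈ Ioo 0 Real.pi, ENNReal.ofReal (Real.sin φ ^ (-β)) ≤
      ENNReal.ofReal ((2 / Real.pi) ^ (-β)) *
        (ENNReal.ofReal (φ ^ (-β)) + ENNReal.ofReal ((Real.pi - φ) ^ (-β))) := by
    rintro φ ⟨hφ, hφπ⟩
    rw [mul_add]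
    rcases le_total φ (Real.pi / 2) with h | h
    · exact (hjordan φ hφ h).trans le_self_add
    · rw [← Real.sin_pi_sub]
      exact (hjordan _ (by linarith) (by linarith)).trans le_add_self
  refine (setLIntegral_mono (by fun_prop) hpt).trans_lt ?_
  rw [lintegral_const_mul _ (by fun_prop), lintegral_add_left (by fun_prop),
    lintegral_rpow_Ioo hπ (by linarith), lintegral_sub_rpow_Ioo hπ (by linarith)]
  finiteness

end PowerIntegrals

section WrightMoments

/-- The layer of the Kanter-Zolotarev representation of `wrightDensity α` with parameter
`b = kanter α φ`. -/
noncomputable def wrightKernel (α b θ : ℝ) : ℝ :=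
  (1 - α)⁻¹ * b ^ (1 - α)⁻¹ * θ ^ (α / (1 - α)) * Real.exp (-(θ * b) ^ (1 - α)⁻¹)

variable {α b r β θ : ℝ}

theorem lintegral_wrightKernel_mul_rpow (h1 : α < 1) (hb : 0 < b) (hr : -1 < (1 - α) * r) :
    ∫⁻ θ in Ioi 0, ENNReal.ofReal (wrightKernel α b θ * θ ^ r) =
      ENNReal.ofReal (b ^ (-r) * Real.Gamma (1 + (1 - α) * r)) := by
  have hc : 0 < 1 - α := sub_pos.2 h1
  have hq : -1 < r + α / (1 - α) := by
    rw [← sub_pos, show r + α / (1 - α) - -1 = (1 + (1 - α) * r) / (1 - α) by field_simp; ring]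
    exact div_pos (by linarith) hc
  set B := b ^ (1 - α)⁻¹ with hB
  have hB0 : 0 < B := by positivity
  have hform : ∀ θ ∈ Ioi (0 : ℝ), ENNReal.ofReal (wrightKernel α b θ * θ ^ r) =
      ENNReal.ofReal ((1 - α)⁻¹ * B) *
        ENNReal.ofReal (θ ^ (r + α / (1 - α)) * Real.exp (-B * θ ^ (1 - α)⁻¹)) := by
    intro θ (hθ : 0 < θ)
    rw [← ENNReal.ofReal_mul (by positivity), Real.rpow_add hθ, wrightKernel,
      Real.mul_rpow hθ.le hb.le, neg_mul, mul_comm (θ ^ (1 - α)⁻¹)]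
    congr 1
    ring
  rw [setLIntegral_congr_fun measurableSet_Ioi hform, lintegral_const_mul _ (by fun_prop),
    ← ofReal_integral_eq_lintegral_ofReal
      (integrableOn_rpow_mul_exp_neg_mul_rpow hq (inv_pos.2 hc) hB0)
      (ae_restrict_of_forall_mem measurableSet_Ioi fun θ (hθ : 0 < θ) => by positivity),
    integral_rpow_mul_exp_neg_mul_rpow (inv_pos.2 hc) hq hB0,
    ← ENNReal.ofReal_mul (by positivity),
    show (r + α / (1 - α) + 1) / (1 - α)⁻¹ = 1 + (1 - α) * r by field_simp; ring,
    hB, ← Real.rpow_mul hb.le,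
    show (1 - α)⁻¹ * (-(r + α / (1 - α) + 1) / (1 - α)⁻¹) = -(1 - α)⁻¹ + -r by field_simp; ring,
    Real.rpow_add hb, Real.rpow_neg hb.le (1 - α)⁻¹, ← hB]
  congr 1
  field_simp

theorem lintegral_wrightKernel_mul_rpow_neg_le (h0 : 0 ≤ α) (h1 : α < 1) (hb : 0 < b) (hβ0 : 0 ≤ β)
    (hβ : β < 1) :
    ∫⁻ θ in Ioi 0, ENNReal.ofReal (wrightKernel α b θ * θ ^ (-β)) ≤
      ENNReal.ofReal (b ^ β * Real.Gamma (1 - β)) := by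
  have hle : (1 - α) * β ≤ β := mul_le_of_le_one_left hβ0 (by linarith)
  rw [lintegral_wrightKernel_mul_rpow h1 hb (by linarith), neg_neg]
  gcongr
  refine Real.Gamma_strictAntiOn_Ioc.antitoneOn ⟨by linarith, by linarith⟩
    ⟨by linarith, ?_⟩ (by linarith)
  nlinarith [mul_nonneg (sub_nonneg.2 h1.le) hβ0]

theorem measurable_wrightKernel_kanter (α : ℝ) :
    Measurable fun q : ℝ × ℝ => wrightKernel α (kanter α q.2) q.1 :=
  wright_integrand_measurable α

theorem wrightKernel_kanter_nonneg {φ : ℝ} (h0 : 0 < α) (h1 : α < 1) (hφ : φ ∈ Ioo 0 Real.pi)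
    (hθ : 0 ≤ θ) : 0 ≤ wrightKernel α (kanter α φ) θ := by
  have := kanter_pos h0 h1 hφ
  have := sub_pos.2 h1
  simp only [wrightKernel]
  positivity

theorem wrightDensity_eq_integral_wrightKernel (α θ : ℝ) :
    wrightDensity α θ = Real.pi⁻¹ * ∫ φ in Ioo 0 Real.pi, wrightKernel α (kanter α φ) θ := by
  rw [wrightDensity, intervalIntegral.integral_of_le Real.pi_pos.le, integral_Ioc_eq_integral_Ioo]
  simp only [wrightKernel]

theorem kanter_le_inv_sin {φ : ℝ} (h0 : 0 < α) (h1 : α < 1) (hφ : φ ∈ Ioo 0 Real.pi) :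
    kanter α φ ≤ (Real.sin φ)⁻¹ := by
  have hsin := sin_mul_pos h0 h1 hφ
  have hsin' := sin_mul_pos (sub_pos.2 h1) (by linarith) hφ
  have := Real.sin_pos_of_pos_of_lt_pi hφ.1 hφ.2
  rw [kanter, ← one_div]
  gcongr
  exact mul_le_one₀ (Real.rpow_le_one hsin.le (Real.sin_le_one _) h0.le) (by positivity)
    (Real.rpow_le_one hsin'.le (Real.sin_le_one _) (by linarith))

theorem ofReal_wrightDensity_le (h0 : 0 < α) (h1 : α < 1) (hθ : 0 < θ) :
    ENNReal.ofReal (wrightDensity α θ) ≤ ENNReal.ofReal Real.pi⁻¹ *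
      ∫⁻ φ in Ioo 0 Real.pi, ENNReal.ofReal (wrightKernel α (kanter α φ) θ) := by
  rw [wrightDensity_eq_integral_wrightKernel, ENNReal.ofReal_mul (by positivity),
    integral_eq_lintegral_of_nonneg_ae
      (ae_restrict_of_forall_mem measurableSet_Ioo fun φ hφ =>
        wrightKernel_kanter_nonneg h0 h1 hφ hθ.le)
      ((measurable_wrightKernel_kanter α).comp measurable_prodMk_left).aestronglyMeasurable]
  gcongr
  exact ENNReal.ofReal_toReal_le

theorem lintegral_wrightDensity_mul_rpow_neg_le (h0 : 0 < α) (h1 : α < 1) (hβ0 : 0 ≤ β)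
    (hβ : β < 1) :
    ∫⁻ θ in Ioi 0, ENNReal.ofReal (wrightDensity α θ) * ENNReal.ofReal (θ ^ (-β)) ≤
      ENNReal.ofReal (Real.pi⁻¹ * Real.Gamma (1 - β)) *
        ∫⁻ φ in Ioo 0 Real.pi, ENNReal.ofReal (Real.sin φ ^ (-β)) := by
  have hmeas : Measurable fun q : ℝ × ℝ =>
      ENNReal.ofReal (wrightKernel α (kanter α q.2) q.1 * q.1 ^ (-β)) :=
    ((measurable_wrightKernel_kanter α).mul (by fun_prop)).ennreal_ofReal
  have hmoment : ∀ φ ∈ Ioo 0 Real.pi,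
      ∫⁻ θ in Ioi 0, ENNReal.ofReal (wrightKernel α (kanter α φ) θ * θ ^ (-β)) ≤
        ENNReal.ofReal (Real.Gamma (1 - β)) * ENNReal.ofReal (Real.sin φ ^ (-β)) := by
    intro φ hφ
    have hsin := Real.sin_pos_of_pos_of_lt_pi hφ.1 hφ.2
    have hkanter := kanter_pos h0 h1 hφ
    refine (lintegral_wrightKernel_mul_rpow_neg_le h0.le h1 hkanter hβ0 hβ).trans ?_
    have := Real.Gamma_pos_of_pos (sub_pos.2 hβ)
    rw [← ENNReal.ofReal_mul this.le, mul_comm, Real.rpow_neg hsin.le, ← Real.inv_rpow hsin.le]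
    gcongr
    exact kanter_le_inv_sin h0 h1 hφ
  calc ∫⁻ θ in Ioi 0, ENNReal.ofReal (wrightDensity α θ) * ENNReal.ofReal (θ ^ (-β))
      ≤ ∫⁻ θ in Ioi 0, ENNReal.ofReal Real.pi⁻¹ *
          ∫⁻ φ in Ioo 0 Real.pi, ENNReal.ofReal (wrightKernel α (kanter α φ) θ * θ ^ (-β)) := by
        refine setLIntegral_mono (by fun_prop) fun θ (hθ : 0 < θ) => ?_
        simp_rw [ENNReal.ofReal_mul' (Real.rpow_nonneg hθ.le _)]
        rw [lintegral_mul_const' _ _ ENNReal.ofReal_ne_top, ← mul_assoc]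
        gcongr
        exact ofReal_wrightDensity_le h0 h1 hθ
    _ = ENNReal.ofReal Real.pi⁻¹ * ∫⁻ φ in Ioo 0 Real.pi, ∫⁻ θ in Ioi 0,
          ENNReal.ofReal (wrightKernel α (kanter α φ) θ * θ ^ (-β)) := by
        rw [lintegral_const_mul' _ _ ENNReal.ofReal_ne_top,
          lintegral_lintegral_swap (by exact hmeas.aemeasurable)]
    _ ≤ ENNReal.ofReal Real.pi⁻¹ * ∫⁻ φ in Ioo 0 Real.pi,
          ENNReal.ofReal (Real.Gamma (1 - β)) * ENNReal.ofReal (Real.sin φ ^ (-β)) := by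
        exact mul_le_mul_right (setLIntegral_mono (by fun_prop) hmoment) _
    _ = _ := by
        rw [lintegral_const_mul' _ _ ENNReal.ofReal_ne_top, ← mul_assoc,
          ENNReal.ofReal_mul (by positivity)]

theorem lintegral_wrightDensity (h0 : 0 < α) (h1 : α < 1) :
    ∫⁻ θ in Ioi 0, ENNReal.ofReal (wrightDensity α θ) = 1 := by
  have hmass := wrightDensity_moment h0 h1 0
  simp only [pow_zero, one_mul, Nat.factorial_zero, Nat.cast_one, CharP.cast_eq_zero, mul_zero,
    add_zero, Real.Gamma_one, div_one] at hmass
  rw [← ofReal_integral_eq_lintegral_ofReal hmass.1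
    (ae_restrict_of_forall_mem measurableSet_Ioi fun θ => wrightDensity_nonneg h0 h1), hmass.2,
    ENNReal.ofReal_one]

theorem lintegral_mul_wrightDensity_le (h0 : 0 < α) (h1 : α < 1) :
    ∫⁻ θ in Ioi 0, ENNReal.ofReal (θ * wrightDensity α θ) ≤ 2 := by
  have hmean := wrightDensity_moment h0 h1 1
  simp only [pow_one, Nat.factorial_one, Nat.cast_one, mul_one] at hmean
  have hΓ : 1 ≤ (1 + α) * Real.Gamma (1 + α) := by
    rw [← Real.Gamma_add_one (by linarith)]
    refine Real.Gamma_two.symm.trans_le ?_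
    exact Real.Gamma_strictMonoOn_Ici.monotoneOn self_mem_Ici (mem_Ici.2 (by linarith))
      (by linarith)
  rw [← ofReal_integral_eq_lintegral_ofReal hmean.1
    (ae_restrict_of_forall_mem measurableSet_Ioi fun θ (hθ : 0 < θ) =>
      mul_nonneg hθ.le (wrightDensity_nonneg h0 h1 hθ)), hmean.2, ENNReal.ofReal_le_ofNat,
    div_le_iff₀ (Real.Gamma_pos_of_pos (by linarith))]
  nlinarith

theorem exists_lintegral_wrightDensity_mul_le (hβ0 : 0 ≤ β) (hβ : β < 1) :
    ∃ C : ℝ≥0, ∀ α : ℝ, 0 < α → α < 1 →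
      ∫⁻ θ in Ioi 0, ENNReal.ofReal (wrightDensity α θ) * (1 + ENNReal.ofReal (θ ^ (-β))) ≤ C := by
  set M := ENNReal.ofReal (Real.pi⁻¹ * Real.Gamma (1 - β)) *
    ∫⁻ φ in Ioo 0 Real.pi, ENNReal.ofReal (Real.sin φ ^ (-β))
  have hM_top : M ≠ ∞ :=
    ENNReal.mul_ne_top ENNReal.ofReal_ne_top (lintegral_sin_rpow_neg_lt_top hβ0 hβ).ne
  refine ⟨1 + M.toNNReal, fun α h0 h1 => ?_⟩
  simp_rw [mul_add, mul_one]
  rw [lintegral_add_left (measurable_wrightDensity α).ennreal_ofReal, lintegral_wrightDensity h0 h1,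
    ENNReal.coe_add, ENNReal.coe_one, ENNReal.coe_toNNReal hM_top]
  gcongr
  exact lintegral_wrightDensity_mul_rpow_neg_le h0 h1 hβ0 hβ

theorem lintegral_mul_wrightDensity_mul_le (h0 : 0 < α) (h1 : α < 1) (hβ0 : 0 ≤ β) (hβ : β < 1) :
    ∫⁻ θ in Ioi 0, ENNReal.ofReal (θ * wrightDensity α θ) * (1 + ENNReal.ofReal (θ ^ (-β))) ≤
      5 := by
  have hmeas := measurable_wrightDensity α
  have hpt : ∀ θ ∈ Ioi (0 : ℝ),
      ENNReal.ofReal (θ * wrightDensity α θ) * (1 + ENNReal.ofReal (θ ^ (-β))) ≤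
        2 * ENNReal.ofReal (θ * wrightDensity α θ) + ENNReal.ofReal (wrightDensity α θ) := by
    intro θ (hθ : 0 < θ)
    have hh := wrightDensity_nonneg h0 h1 hθ
    have hpow : θ * θ ^ (-β) ≤ 1 + θ := by
      rcases le_total θ 1 with hθ1 | hθ1
      · have : θ ^ (-β) ≤ θ ^ (-1 : ℝ) :=
          Real.rpow_le_rpow_of_exponent_ge hθ hθ1 (by linarith)
        rw [Real.rpow_neg_one] at this
        calc θ * θ ^ (-β) ≤ θ * θ⁻¹ := by gcongr
          _ ≤ 1 + θ := by rw [mul_inv_cancel₀ hθ.ne']; linarith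
      · have := Real.rpow_le_one_of_one_le_of_nonpos hθ1 (neg_nonpos.2 hβ0)
        nlinarith
    rw [← ENNReal.ofReal_one, ← ENNReal.ofReal_add one_pos.le (by positivity),
      ← ENNReal.ofReal_mul (by positivity), ← ENNReal.ofReal_ofNat 2,
      ← ENNReal.ofReal_mul two_pos.le, ← ENNReal.ofReal_add (by positivity) hh]
    refine ENNReal.ofReal_le_ofReal ?_
    linarith [mul_le_mul_of_nonneg_right hpow hh]
  calc _ ≤ 2 * (∫⁻ θ in Ioi 0, ENNReal.ofReal (θ * wrightDensity α θ)) +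
        ∫⁻ θ in Ioi 0, ENNReal.ofReal (wrightDensity α θ) := by
        rw [← lintegral_const_mul _ (by fun_prop), ← lintegral_add_left (by fun_prop)]
        exact setLIntegral_mono (by fun_prop) hpt
    _ ≤ 2 * 2 + 1 := by
        gcongr
        exacts [lintegral_mul_wrightDensity_le h0 h1, (lintegral_wrightDensity h0 h1).le]
    _ = 5 := by norm_num

end WrightMoments

section UniformlyLocal

variable {X : Type*} [PseudoMetricSpace X]

/-- The uniformly local mass of `ν` at scale `R`: the largest mass carried by a ball of
radius `R`. -/
noncomputable def ulocMass [MeasurableSpace X] (R : ℝ) (ν : Measure X) : ℝ≥0∞ :=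
  ⨆ z, ν (Metric.ball z R)

theorem measure_ball_le_ulocMass [MeasurableSpace X] (R : ℝ) (ν : Measure X) (z : X) :
    ν (Metric.ball z R) ≤ ulocMass R ν :=
  le_iSup (fun z => ν (Metric.ball z R)) z

variable [MeasureSpace X]

/-- The uniformly local `L^p` norm of a nonnegative function at scale `R`. -/
noncomputable def ulocNorm (p R : ℝ) (f : X → ℝ≥0∞) : ℝ≥0∞ :=
  ⨆ z, (∫⁻ y in Metric.ball z R, f y ^ p) ^ (1 / p)

variable {p R : ℝ}

theorem lintegral_ball_rpow_le_ulocNorm (p R : ℝ) (f : X → ℝ≥0∞) (z : X) :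
    (∫⁻ y in Metric.ball z R, f y ^ p) ^ (1 / p) ≤ ulocNorm p R f :=
  le_iSup (fun z => (∫⁻ y in Metric.ball z R, f y ^ p) ^ (1 / p)) z

theorem ulocMass_withDensity_rpow [OpensMeasurableSpace X] (hp : 0 < p) (f : X → ℝ≥0∞) :
    ulocMass R (volume.withDensity fun y => f y ^ p) = ulocNorm p R f ^ p := by
  rw [ulocNorm, ← ENNReal.orderIsoRpow_apply p hp, OrderIso.map_iSup]
  refine iSup_congr fun z => ?_
  rw [withDensity_apply _ Metric.isOpen_ball.measurableSet, ENNReal.orderIsoRpow_apply,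
    ← ENNReal.rpow_mul, one_div_mul_cancel hp.ne', ENNReal.rpow_one]

theorem ulocNorm_add_le (hp : 1 ≤ p) {f g : X → ℝ≥0∞} (hf : Measurable f) (hg : Measurable g) :
    ulocNorm p R (fun x => f x + g x) ≤ ulocNorm p R f + ulocNorm p R g :=
  iSup_le fun z => (ENNReal.lintegral_Lp_add_le hf.aemeasurable hg.aemeasurable hp).trans <|
    add_le_add (lintegral_ball_rpow_le_ulocNorm p R f z) (lintegral_ball_rpow_le_ulocNorm p R g z)

theorem ulocNorm_const_mul (hp : 0 < p) (c : ℝ≥0∞) {f : X → ℝ≥0∞} (hf : Measurable f) :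
    ulocNorm p R (fun x => c * f x) = c * ulocNorm p R f := by
  simp_rw [ulocNorm, ENNReal.mul_iSup, ENNReal.mul_rpow_of_nonneg _ _ hp.le,
    lintegral_const_mul _ (hf.pow_const p), ENNReal.mul_rpow_of_nonneg _ _ (one_div_pos.2 hp).le,
    ← ENNReal.rpow_mul, mul_one_div_cancel hp.ne', ENNReal.rpow_one]

theorem ulocNorm_le_mul_ulocMass_rpow [OpensMeasurableSpace X] (hp : 1 ≤ p) {f : X → ℝ≥0∞}
    {M : ℝ≥0∞} (hM : ∀ x, f x ≤ M) (hf : Measurable f) :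
    ulocNorm p R f ≤ M ^ (1 - 1 / p) * ulocMass R (volume.withDensity f) ^ (1 / p) := by
  have hp0 : 0 < p := by linarith
  refine iSup_le fun z => ?_
  calc (∫⁻ y in Metric.ball z R, f y ^ p) ^ (1 / p)
      ≤ (∫⁻ y in Metric.ball z R, M ^ (p - 1) * f y) ^ (1 / p) := by
        gcongr with y
        calc f y ^ p = f y ^ (p - 1) * f y ^ (1 : ℝ) := by
              rw [← ENNReal.rpow_add_of_nonneg _ _ (by linarith) zero_le_one, sub_add_cancel]
          _ ≤ M ^ (p - 1) * f y := by
              rw [ENNReal.rpow_one]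
              gcongr
              exact hM y
    _ = M ^ (1 - 1 / p) * (volume.withDensity f (Metric.ball z R)) ^ (1 / p) := by
        rw [lintegral_const_mul _ hf, ENNReal.mul_rpow_of_nonneg _ _ (by positivity),
          ← ENNReal.rpow_mul, withDensity_apply _ Metric.isOpen_ball.measurableSet,
          mul_one_div, sub_div, div_self hp0.ne']
    _ ≤ _ := by
        gcongr
        exact measure_ball_le_ulocMass R _ z

theorem ulocNorm_lintegral_le [SFinite (volume : Measure X)] {A : Type*} [MeasurableSpace A]
    {κ : Measure A} [SFinite κ] (hp : 1 ≤ p) {f : A → X → ℝ≥0∞}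
    (hf : Measurable (Function.uncurry f)) :
    ulocNorm p R (fun x => ∫⁻ a, f a x ∂κ) ≤ ∫⁻ a, ulocNorm p R (f a) ∂κ :=
  iSup_le fun z => (lintegral_Lp_lintegral_le hp hf).trans <| lintegral_mono fun a =>
    lintegral_ball_rpow_le_ulocNorm p R (f a) z

theorem ulocNorm_iSup (hp : 0 < p) {f : ℕ → X → ℝ≥0∞} (hf : ∀ n, Measurable (f n))
    (hmono : Monotone f) :
    ulocNorm p R (fun x => ⨆ n, f n x) = ⨆ n, ulocNorm p R (f n) := by
  simp only [ulocNorm]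
  rw [iSup_comm]
  refine iSup_congr fun z => ?_
  have hpow (x : X) : (⨆ n, f n x) ^ p = ⨆ n, f n x ^ p :=
    (ENNReal.orderIsoRpow p hp).map_iSup _
  simp only [hpow]
  rw [lintegral_iSup (fun n => (hf n).pow_const p)
    fun m n hmn x => ENNReal.rpow_le_rpow (hmono hmn x) hp.le]
  exact (ENNReal.orderIsoRpow _ (one_div_pos.2 hp)).map_iSup _

theorem ae_lt_top_of_ulocNorm_lt_top [OpensMeasurableSpace X] [SecondCountableTopology X]
    (hp : 0 < p) (hR : 0 < R) {f : X → ℝ≥0∞} (hf : Measurable f) (h : ulocNorm p R f < ∞) :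
    ∀ᵐ x, f x < ∞ := by
  refine measure_null_of_locally_null _ fun z _ =>
    ⟨_, inter_mem_nhdsWithin _ (Metric.ball_mem_nhds z hR), ?_⟩
  have hz : ∫⁻ y in Metric.ball z R, f y ^ p ≠ ∞ :=
    ((ENNReal.rpow_lt_top_iff_of_pos (one_div_pos.2 hp)).1
      ((lintegral_ball_rpow_le_ulocNorm p R f z).trans_lt h)).ne
  have hfin : ∀ᵐ y ∂volume.restrict (Metric.ball z R), f y < ∞ :=
    (ae_lt_top (hf.pow_const p) hz).mono fun y => (ENNReal.rpow_lt_top_iff_of_pos hp).1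
  rwa [ae_iff, Measure.restrict_apply' Metric.isOpen_ball.measurableSet] at hfin

end UniformlyLocal

section Convolution

theorem withDensity_conv {G : Type*} [AddCommGroup G] [MeasurableSpace G] [MeasurableAdd₂ G]
    [MeasurableSub₂ G] (κ ν : Measure G) [SFinite κ] [SFinite ν] [κ.IsAddRightInvariant]
    {k : G → ℝ≥0∞} (hk : Measurable k) :
    κ.withDensity k ∗ ν = κ.withDensity fun x => ∫⁻ y, k (x - y) ∂ν := by
  have hk2 : Measurable fun q : G × G => k (q.1 - q.2) := by fun_prop
  refine Measure.ext_of_lintegral _ fun f hf => ?_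
  calc ∫⁻ z, f z ∂(κ.withDensity k ∗ ν)
      = ∫⁻ y, ∫⁻ w, k w * f (y + w) ∂κ ∂ν := by
        rw [Measure.conv_comm, Measure.lintegral_conv hf]
        exact lintegral_congr fun y => lintegral_withDensity_eq_lintegral_mul _ hk (by fun_prop)
    _ = ∫⁻ y, ∫⁻ x, k (x - y) * f x ∂κ ∂ν := by
        refine lintegral_congr fun y => ?_
        rw [← lintegral_sub_right_eq_self (fun w => k w * f (y + w)) y]
        simp only [add_sub_cancel]
    _ = ∫⁻ x, (∫⁻ y, k (x - y) ∂ν) * f x ∂κ := by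
        rw [lintegral_lintegral_swap (by fun_prop)]
        exact lintegral_congr fun x => lintegral_mul_const _ (by fun_prop)
    _ = ∫⁻ x, f x ∂κ.withDensity fun x => ∫⁻ y, k (x - y) ∂ν :=
        (lintegral_withDensity_eq_lintegral_mul _ hk2.lintegral_prod_right' hf).symm

theorem ulocMass_conv_le {E : Type*} [SeminormedAddCommGroup E] [MeasurableSpace E]
    [OpensMeasurableSpace E] [MeasurableAdd₂ E] (R : ℝ) (κ ν : Measure E) [SFinite ν] :
    ulocMass R (κ ∗ ν) ≤ κ univ * ulocMass R ν := by
  refine iSup_le fun z => ?_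
  have hball (w : E) : ν ((w + ·) ⁻¹' Metric.ball z R) ≤ ulocMass R ν := by
    rw [preimage_add_ball]
    exact measure_ball_le_ulocMass R ν _
  calc (κ ∗ ν) (Metric.ball z R)
      = ∫⁻ w, ν ((w + ·) ⁻¹' Metric.ball z R) ∂κ := by
        rw [Measure.conv, Measure.map_apply measurable_add Metric.isOpen_ball.measurableSet,
          Measure.prod_apply (measurable_add Metric.isOpen_ball.measurableSet)]
        rfl
    _ ≤ ∫⁻ _, ulocMass R ν ∂κ := lintegral_mono hball
    _ = κ univ * ulocMass R ν := by rw [lintegral_const, mul_comm]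

end Convolution

section HeatSmoothing

variable {N : ℕ}

@[fun_prop]
theorem measurable_heatKernel_comp {Y : Type*} [MeasurableSpace Y] {f : Y → ℝ}
    {g : Y → EuclideanSpace ℝ (Fin N)} (hf : Measurable f) (hg : Measurable g) :
    Measurable fun a => heatKernel (f a) (g a) := by
  unfold heatKernel
  fun_prop

theorem lintegral_heatKernel {s : ℝ} (hs : 0 < s) :
    ∫⁻ x : EuclideanSpace ℝ (Fin N), ENNReal.ofReal (heatKernel s x) = 1 := by
  have hint : ∫ x : EuclideanSpace ℝ (Fin N), heatKernel s x = 1 := by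
    have hgauss := GaussianFourier.integral_rexp_neg_mul_sq_norm (V := EuclideanSpace ℝ (Fin N))
      (b := (4 * s)⁻¹) (by positivity)
    have hpos : 0 < (4 * Real.pi * s) ^ ((N : ℝ) / 2) := by positivity
    simp only [heatKernel, neg_div, div_eq_inv_mul (‖_‖ ^ 2), ← neg_mul, integral_const_mul]
    rw [hgauss, finrank_euclideanSpace_fin, div_inv_eq_mul, ← mul_assoc, mul_comm Real.pi,
      one_div_mul_cancel hpos.ne']
  rw [← ofReal_integral_eq_lintegral_ofReal (not_imp_comm.1 integral_undef (by simp [hint])),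
    hint, ENNReal.ofReal_one]
  exact ae_of_all _ fun x => by unfold heatKernel; positivity

theorem heatKernel_le_of_sq_le {s : ℝ} (hs : 0 < s) {x y : EuclideanSpace ℝ (Fin N)}
    (h : ‖x - y‖ ^ 2 ≤ s) :
    heatKernel s x ≤ 2 ^ ((N : ℝ) / 2) * Real.exp (1 / 4) * heatKernel (2 * s) y := by
  have hnorm : ‖y‖ ^ 2 ≤ 2 * ‖x‖ ^ 2 + 2 * s := by
    have htri : ‖y‖ ≤ ‖x‖ + ‖x - y‖ := by simpa using norm_sub_le x (x - y)
    nlinarith [norm_nonneg y, sq_nonneg (‖x‖ - ‖x - y‖)]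
  have hexp : -‖x‖ ^ 2 / (4 * s) ≤ 1 / 4 + -‖y‖ ^ 2 / (4 * (2 * s)) := by
    rw [← sub_nonneg]
    calc 0 ≤ (2 * ‖x‖ ^ 2 + 2 * s - ‖y‖ ^ 2) / (8 * s) :=
          div_nonneg (sub_nonneg.2 hnorm) (by positivity)
      _ = _ := by field_simp; ring
  calc heatKernel s x
      ≤ 1 / (4 * Real.pi * s) ^ ((N : ℝ) / 2) * Real.exp (1 / 4 + -‖y‖ ^ 2 / (4 * (2 * s))) := by
        unfold heatKernel
        gcongr
    _ = _ := by
        rw [heatKernel, Real.exp_add, show 4 * Real.pi * (2 * s) = 2 * (4 * Real.pi * s) by ring,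
          Real.mul_rpow (x := 2) (by norm_num) (by positivity)]
        field_simp

@[fun_prop]
theorem measurable_heatSemigroup_comp (ν : Measure (EuclideanSpace ℝ (Fin N))) [SFinite ν]
    {Y : Type*} [MeasurableSpace Y] {f : Y → ℝ} {g : Y → EuclideanSpace ℝ (Fin N)}
    (hf : Measurable f) (hg : Measurable g) :
    Measurable fun a => heatSemigroup (f a) ν (g a) := by
  have hk : Measurable fun r : Y × EuclideanSpace ℝ (Fin N) =>
      ENNReal.ofReal (heatKernel (f r.1) (g r.1 - r.2)) := by fun_prop
  exact hk.lintegral_prod_right'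

theorem heatSemigroup_le_of_sq_le (ν : Measure (EuclideanSpace ℝ (Fin N))) {s : ℝ} (hs : 0 < s)
    {x y : EuclideanSpace ℝ (Fin N)} (h : ‖x - y‖ ^ 2 ≤ s) :
    heatSemigroup s ν x ≤
      ENNReal.ofReal (2 ^ ((N : ℝ) / 2) * Real.exp (1 / 4)) * heatSemigroup (2 * s) ν y := by
  unfold heatSemigroup
  rw [← lintegral_const_mul' _ _ ENNReal.ofReal_ne_top]
  refine lintegral_mono fun w => ?_
  rw [← ENNReal.ofReal_mul (by positivity)]
  exact ENNReal.ofReal_le_ofReal (heatKernel_le_of_sq_le hs (by rwa [sub_sub_sub_cancel_right]))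

theorem ulocMass_withDensity_heatSemigroup_le (ν : Measure (EuclideanSpace ℝ (Fin N)))
    [SFinite ν] {s : ℝ} (hs : 0 < s) (R : ℝ) :
    ulocMass R (volume.withDensity (heatSemigroup s ν)) ≤ ulocMass R ν := by
  have hk : Measurable fun x : EuclideanSpace ℝ (Fin N) => ENNReal.ofReal (heatKernel s x) := by
    fun_prop
  calc ulocMass R (volume.withDensity (heatSemigroup s ν))
      = ulocMass R (volume.withDensity (fun x => ENNReal.ofReal (heatKernel s x)) ∗ ν) := by
        rw [withDensity_conv volume ν hk]
        rfl
    _ ≤ (∫⁻ x, ENNReal.ofReal (heatKernel s x)) * ulocMass R ν := by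
        rw [← setLIntegral_univ, ← withDensity_apply _ MeasurableSet.univ]
        exact ulocMass_conv_le R _ ν
    _ = ulocMass R ν := by rw [lintegral_heatKernel hs, one_mul]

theorem heatSemigroup_mul_volume_ball_le (ν : Measure (EuclideanSpace ℝ (Fin N))) [SFinite ν]
    {R s r : ℝ} (hR : 0 ≤ R) (hr : 0 < r) (hrs : r ≤ s) (hrR : r ≤ R ^ 2)
    (x : EuclideanSpace ℝ (Fin N)) :
    heatSemigroup s ν x * volume (Metric.ball x √r) ≤
      ENNReal.ofReal (2 ^ ((N : ℝ) / 2) * Real.exp (1 / 4)) * ulocMass R ν := by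
  have hs : 0 < s := hr.trans_le hrs
  have hmeas : Measurable (heatSemigroup (2 * s) ν) := by fun_prop
  generalize hK : ENNReal.ofReal (2 ^ ((N : ℝ) / 2) * Real.exp (1 / 4)) = K
  calc heatSemigroup s ν x * volume (Metric.ball x √r)
      = ∫⁻ _ in Metric.ball x √r, heatSemigroup s ν x := (setLIntegral_const _ _).symm
    _ ≤ ∫⁻ y in Metric.ball x √r, K * heatSemigroup (2 * s) ν y := by
        refine setLIntegral_mono' Metric.isOpen_ball.measurableSet fun y hy =>
          (heatSemigroup_le_of_sq_le ν hs (le_trans ?_ hrs)).trans_eq (by rw [hK])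
        rw [← Real.le_sqrt (norm_nonneg _) hr.le, norm_sub_rev, ← dist_eq_norm]
        exact (Metric.mem_ball.1 hy).le
    _ ≤ ∫⁻ y in Metric.ball x R, K * heatSemigroup (2 * s) ν y :=
        lintegral_mono_set (Metric.ball_subset_ball (Real.sqrt_le_iff.2 ⟨hR, hrR⟩))
    _ = K * volume.withDensity (heatSemigroup (2 * s) ν) (Metric.ball x R) := by
        rw [lintegral_const_mul _ hmeas, withDensity_apply _ Metric.isOpen_ball.measurableSet]
    _ ≤ K * ulocMass R ν := by
        gcongr
        exact (measure_ball_le_ulocMass R _ x).trans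
          (ulocMass_withDensity_heatSemigroup_le ν (by positivity) R)

variable (N) in
theorem exists_heatSemigroup_le :
    ∃ C : ℝ≥0, ∀ (ν : Measure (EuclideanSpace ℝ (Fin N))) [SFinite ν] (R s r : ℝ),
      0 ≤ R → 0 < r → r ≤ s → r ≤ R ^ 2 → ∀ x,
        heatSemigroup s ν x ≤ C * ENNReal.ofReal (r ^ (-((N : ℝ) / 2))) * ulocMass R ν := by
  set ω := volume (Metric.ball (0 : EuclideanSpace ℝ (Fin N)) 1)
  set K := ENNReal.ofReal (2 ^ ((N : ℝ) / 2) * Real.exp (1 / 4))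
  have hω0 : ω ≠ 0 := (Metric.measure_ball_pos _ _ one_pos).ne'
  have hωT : ω ≠ ∞ := measure_ball_lt_top.ne
  refine ⟨(K / ω).toNNReal, fun ν _ R s r hR hr hrs hrR x => ?_⟩
  have hrN : 0 < r ^ ((N : ℝ) / 2) := by positivity
  have hvol : volume (Metric.ball x √r) = ENNReal.ofReal (r ^ ((N : ℝ) / 2)) * ω := by
    rw [Measure.addHaar_ball_of_pos _ _ (Real.sqrt_pos.2 hr), finrank_euclideanSpace_fin,
      Real.sqrt_eq_rpow, ← Real.rpow_mul_natCast hr.le, one_div_mul_eq_div]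
  calc heatSemigroup s ν x
      ≤ K * ulocMass R ν / (ENNReal.ofReal (r ^ ((N : ℝ) / 2)) * ω) := by
        rw [ENNReal.le_div_iff_mul_le (.inl (mul_ne_zero (by simpa using hrN) hω0))
          (.inl (ENNReal.mul_ne_top ENNReal.ofReal_ne_top hωT)), ← hvol]
        exact heatSemigroup_mul_volume_ball_le ν hR hr hrs hrR x
    _ = _ := by
        rw [ENNReal.coe_toNNReal (ENNReal.div_ne_top ENNReal.ofReal_ne_top hω0),
          Real.rpow_neg hr.le, ENNReal.ofReal_inv_of_pos hrN, ENNReal.div_eq_inv_mul,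
          ENNReal.div_eq_inv_mul, ENNReal.mul_inv (.inr hωT) (.inl ENNReal.ofReal_ne_top)]
        ring

/-- The exponent `β` of the smoothing estimate `‖e^{sΔ} ν‖_p ≲ s ^ (-β) ‖ν‖₁`. -/
noncomputable def smoothingExponent (N : ℕ) (p : ℝ) : ℝ := (N : ℝ) / 2 * (1 - 1 / p)

variable (N) in
theorem exists_ulocNorm_heatSemigroup_le {p : ℝ} (hp : 1 ≤ p) :
    ∃ C : ℝ≥0, ∀ (ν : Measure (EuclideanSpace ℝ (Fin N))) [SFinite ν] (R s r : ℝ),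
      0 ≤ R → 0 < r → r ≤ s → r ≤ R ^ 2 →
        ulocNorm p R (heatSemigroup s ν) ≤
          C * ENNReal.ofReal (r ^ (-smoothingExponent N p)) * ulocMass R ν := by
  obtain ⟨C, hC⟩ := exists_heatSemigroup_le N
  have hq : 0 ≤ 1 - 1 / p := sub_nonneg.2 ((div_le_one (by linarith)).2 hp)
  refine ⟨C ^ (1 - 1 / p), fun ν _ R s r hR hr hrs hrR => ?_⟩
  calc ulocNorm p R (heatSemigroup s ν)
      ≤ (C * ENNReal.ofReal (r ^ (-((N : ℝ) / 2))) * ulocMass R ν) ^ (1 - 1 / p) *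
          ulocMass R (volume.withDensity (heatSemigroup s ν)) ^ (1 / p) :=
        ulocNorm_le_mul_ulocMass_rpow hp (hC ν R s r hR hr hrs hrR)
          (by fun_prop)
    _ ≤ (C * ENNReal.ofReal (r ^ (-((N : ℝ) / 2))) * ulocMass R ν) ^ (1 - 1 / p) *
          ulocMass R ν ^ (1 / p) := by
        gcongr
        exact ulocMass_withDensity_heatSemigroup_le ν (hr.trans_le hrs) R
    _ = _ := by
        rw [ENNReal.mul_rpow_of_nonneg _ _ hq, ENNReal.mul_rpow_of_nonneg _ _ hq, mul_assoc _ _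
          (_ ^ (1 / p)), ← ENNReal.rpow_add_of_nonneg _ _ hq (by positivity), sub_add_cancel,
          ENNReal.rpow_one, ENNReal.ofReal_rpow_of_pos (by positivity), ← Real.rpow_mul hr.le,
          ENNReal.coe_rpow_of_nonneg _ hq, smoothingExponent, neg_mul]

end HeatSmoothing

section Subordination

variable {N : ℕ}

/-- The average `∫₀^∞ w(θ) e^{τθΔ} ν dθ` of the heat semigroup. The operators `opP α t` and
`opS α t` are the averages with `τ = t ^ α` and weights `h_α(θ)` and `θ h_α(θ)`. -/
noncomputable def subordinatedHeat (w : ℝ → ℝ≥0∞) (τ : ℝ)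
    (ν : Measure (EuclideanSpace ℝ (Fin N))) (x : EuclideanSpace ℝ (Fin N)) : ℝ≥0∞ :=
  ∫⁻ θ in Ioi (0 : ℝ), w θ * heatSemigroup (τ * θ) ν x

variable {w : ℝ → ℝ≥0∞}

theorem opP_eq_subordinatedHeat (α t : ℝ) (ν : Measure (EuclideanSpace ℝ (Fin N))) :
    opP α t ν = subordinatedHeat (fun θ => ENNReal.ofReal (wrightDensity α θ)) (t ^ α) ν :=
  rfl

theorem opS_eq_subordinatedHeat (α t : ℝ) (ν : Measure (EuclideanSpace ℝ (Fin N))) :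
    opS α t ν = subordinatedHeat (fun θ => ENNReal.ofReal (θ * wrightDensity α θ)) (t ^ α) ν :=
  rfl

theorem measurable_subordinatedHeat (hw : Measurable w) {Y : Type*} [MeasurableSpace Y]
    {f : Y → ℝ} {ν : Y → Measure (EuclideanSpace ℝ (Fin N))} {g : Y → EuclideanSpace ℝ (Fin N)}
    (hν : Measurable fun r : Y × ℝ => heatSemigroup (f r.1 * r.2) (ν r.1) (g r.1)) :
    Measurable fun a => subordinatedHeat w (f a) (ν a) (g a) :=
  ((hw.comp measurable_snd).mul hν).lintegral_prod_right'

theorem heatSemigroup_withDensity (s : ℝ) {f : EuclideanSpace ℝ (Fin N) → ℝ≥0∞}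
    (hf : Measurable f) (x : EuclideanSpace ℝ (Fin N)) :
    heatSemigroup s (volume.withDensity f) x =
      ∫⁻ y, f y * ENNReal.ofReal (heatKernel s (x - y)) :=
  lintegral_withDensity_eq_lintegral_mul _ hf (by fun_prop)

theorem measurable_heatSemigroup_withDensity {Y : Type*} [MeasurableSpace Y] {f : Y → ℝ}
    {F : Y → EuclideanSpace ℝ (Fin N) → ℝ≥0∞} {g : Y → EuclideanSpace ℝ (Fin N)}
    (hf : Measurable f) (hF : Measurable (Function.uncurry F)) (hg : Measurable g) :
    Measurable fun a => heatSemigroup (f a) (volume.withDensity (F a)) (g a) := by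
  simp only [heatSemigroup_withDensity _ hF.of_uncurry_left]
  have hFk : Measurable fun r : Y × EuclideanSpace ℝ (Fin N) =>
      F r.1 r.2 * ENNReal.ofReal (heatKernel (f r.1) (g r.1 - r.2)) := by fun_prop
  exact hFk.lintegral_prod_right'

theorem subordinatedHeat_mono (w : ℝ → ℝ≥0∞) (τ : ℝ)
    {ν ν' : Measure (EuclideanSpace ℝ (Fin N))} (h : ν ≤ ν') (x : EuclideanSpace ℝ (Fin N)) :
    subordinatedHeat w τ ν x ≤ subordinatedHeat w τ ν' x := by
  unfold subordinatedHeat heatSemigroup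
  gcongr

theorem subordinatedHeat_withDensity_iSup (hw : Measurable w) (τ : ℝ)
    {f : ℕ → EuclideanSpace ℝ (Fin N) → ℝ≥0∞} (hf : ∀ n, Measurable (f n)) (hmono : Monotone f)
    (x : EuclideanSpace ℝ (Fin N)) :
    subordinatedHeat w τ (volume.withDensity fun y => ⨆ n, f n y) x =
      ⨆ n, subordinatedHeat w τ (volume.withDensity (f n)) x := by
  have hheat (s : ℝ) : heatSemigroup s (volume.withDensity fun y => ⨆ n, f n y) x =
      ⨆ n, heatSemigroup s (volume.withDensity (f n)) x := by
    simp only [heatSemigroup_withDensity s (hf _), heatSemigroup_withDensity s (.iSup hf),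
      ENNReal.iSup_mul]
    refine lintegral_iSup (fun n => (hf n).mul (by fun_prop)) fun m n hmn y => ?_
    gcongr
    exact hmono hmn y
  simp only [subordinatedHeat, hheat, ENNReal.mul_iSup]
  refine lintegral_iSup (fun n => by fun_prop) fun m n hmn θ => ?_
  unfold heatSemigroup
  gcongr
  exact withDensity_mono (ae_of_all _ (hmono hmn))

theorem min_one_rpow_neg_le {β θ : ℝ} (hθ : 0 < θ) : min 1 θ ^ (-β) ≤ 1 + θ ^ (-β) := by
  have : 0 < θ ^ (-β) := by positivity
  rcases min_choice 1 θ with h | h <;> rw [h]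
  · rw [Real.one_rpow]
    linarith
  · linarith

variable (N) in
theorem exists_ulocNorm_subordinatedHeat_le {p : ℝ} (hp : 1 ≤ p) :
    ∃ C : ℝ≥0, ∀ (w : ℝ → ℝ≥0∞) (ν : Measure (EuclideanSpace ℝ (Fin N))) [SFinite ν] (R τ : ℝ),
      Measurable w → 0 ≤ R → 0 < τ → τ ≤ R ^ 2 →
        ulocNorm p R (subordinatedHeat w τ ν) ≤
          C * ENNReal.ofReal (τ ^ (-smoothingExponent N p)) * ulocMass R ν *
            ∫⁻ θ in Ioi 0, w θ * (1 + ENNReal.ofReal (θ ^ (-smoothingExponent N p))) := by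
  obtain ⟨C, hC⟩ := exists_ulocNorm_heatSemigroup_le N hp
  refine ⟨C, fun w ν _ R τ hw hR hτ hτR => ?_⟩
  set β := smoothingExponent N p
  have hpoint (θ : ℝ) (hθ : 0 < θ) : ulocNorm p R (heatSemigroup (τ * θ) ν) ≤
      C * ENNReal.ofReal (τ ^ (-β)) * ulocMass R ν * (1 + ENNReal.ofReal (θ ^ (-β))) := by
    have hmin : 0 < min 1 θ := lt_min one_pos hθ
    calc ulocNorm p R (heatSemigroup (τ * θ) ν)
        ≤ C * ENNReal.ofReal ((τ * min 1 θ) ^ (-β)) * ulocMass R ν :=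
          hC ν R _ _ hR (by positivity) (by gcongr; exact min_le_right 1 θ)
            ((mul_le_of_le_one_right hτ.le (min_le_left 1 θ)).trans hτR)
      _ ≤ C * (ENNReal.ofReal (τ ^ (-β)) * ENNReal.ofReal (1 + θ ^ (-β))) * ulocMass R ν := by
          rw [Real.mul_rpow hτ.le hmin.le, ENNReal.ofReal_mul (by positivity)]
          gcongr
          exact min_one_rpow_neg_le hθ
      _ = _ := by
          rw [ENNReal.ofReal_add zero_le_one (by positivity), ENNReal.ofReal_one]
          ring
  calc ulocNorm p R (subordinatedHeat w τ ν)
      ≤ ∫⁻ θ in Ioi 0, ulocNorm p R fun x => w θ * heatSemigroup (τ * θ) ν x :=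
        ulocNorm_lintegral_le hp (by simp only [Function.uncurry_def]; fun_prop)
    _ = ∫⁻ θ in Ioi 0, w θ * ulocNorm p R (heatSemigroup (τ * θ) ν) :=
        lintegral_congr fun θ => ulocNorm_const_mul (by linarith) _ (by fun_prop)
    _ ≤ ∫⁻ θ in Ioi 0, C * ENNReal.ofReal (τ ^ (-β)) * ulocMass R ν *
          (w θ * (1 + ENNReal.ofReal (θ ^ (-β)))) := by
        refine setLIntegral_mono' measurableSet_Ioi fun θ hθ => ?_
        rw [mul_left_comm]
        gcongr
        exact hpoint θ hθ
    _ = _ := lintegral_const_mul _ (by fun_prop)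

end Subordination

section SmoothingExponent

variable {N : ℕ} {p : ℝ}

theorem smoothingExponent_nonneg (hp : 1 ≤ p) : 0 ≤ smoothingExponent N p :=
  mul_nonneg (by positivity) (sub_nonneg.2 ((div_le_one (by linarith)).2 hp))

theorem smoothingExponent_mul_self (hp : p ≠ 0) :
    smoothingExponent N p * p = (N : ℝ) / 2 * (p - 1) := by
  rw [smoothingExponent, mul_assoc, sub_mul, one_div_mul_cancel hp, one_mul]

theorem smoothingExponent_lt_one (hp : 1 < p) (h : smoothingExponent N p * p ≤ 1) :
    smoothingExponent N p < 1 := by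
  nlinarith [smoothingExponent_nonneg (N := N) hp.le]

end SmoothingExponent

section WrightSmoothing

variable {N : ℕ} {p : ℝ}

theorem exists_ulocNorm_opP_le (hp : 1 ≤ p) (hβ : smoothingExponent N p < 1) :
    ∃ C : ℝ≥0, ∀ (ν : Measure (EuclideanSpace ℝ (Fin N))) [SFinite ν] (α R t : ℝ),
      0 < α → α < 1 → 0 ≤ R → 0 < t → t ^ α ≤ R ^ 2 →
        ulocNorm p R (opP α t ν) ≤
          C * ENNReal.ofReal (t ^ (-(α * smoothingExponent N p))) * ulocMass R ν := by
  obtain ⟨C₁, hC₁⟩ := exists_ulocNorm_subordinatedHeat_le N hp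
  obtain ⟨C₂, hC₂⟩ := exists_lintegral_wrightDensity_mul_le (smoothingExponent_nonneg hp) hβ
  refine ⟨C₁ * C₂, fun ν _ α R t h0 h1 hR ht htR => ?_⟩
  rw [opP_eq_subordinatedHeat]
  refine (hC₁ _ ν R _ (measurable_wrightDensity α).ennreal_ofReal hR (by positivity) htR).trans ?_
  grw [hC₂ α h0 h1]
  rw [← Real.rpow_mul ht.le, mul_neg, ENNReal.coe_mul]
  exact le_of_eq (by ring)

theorem exists_ulocNorm_opS_le (hp : 1 ≤ p) (hβ : smoothingExponent N p < 1) :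
    ∃ C : ℝ≥0, ∀ (ν : Measure (EuclideanSpace ℝ (Fin N))) [SFinite ν] (α R t : ℝ),
      0 < α → α < 1 → 0 ≤ R → 0 < t → t ^ α ≤ R ^ 2 →
        ulocNorm p R (opS α t ν) ≤
          C * ENNReal.ofReal (t ^ (-(α * smoothingExponent N p))) * ulocMass R ν := by
  obtain ⟨C, hC⟩ := exists_ulocNorm_subordinatedHeat_le N hp
  refine ⟨C * 5, fun ν _ α R t h0 h1 hR ht htR => ?_⟩
  have hw := measurable_wrightDensity α
  rw [opS_eq_subordinatedHeat]
  refine (hC _ ν R _ (by fun_prop) hR (by positivity) htR).trans ?_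
  grw [lintegral_mul_wrightDensity_mul_le h0 h1 (smoothingExponent_nonneg hp) hβ]
  rw [← Real.rpow_mul ht.le, mul_neg, ENNReal.coe_mul]
  exact le_of_eq (by push_cast; ring)

end WrightSmoothing

section MildFormulation

variable {N : ℕ} {α p : ℝ}

/-- The Duhamel term `α ∫₀ᵗ (t - s)^(α - 1) S_α(t - s) g(s) ds` of the source `g`. -/
noncomputable def duhamel (α : ℝ) (g : ℝ → EuclideanSpace ℝ (Fin N) → ℝ≥0∞) (t : ℝ)
    (x : EuclideanSpace ℝ (Fin N)) : ℝ≥0∞ :=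
  ENNReal.ofReal α * ∫⁻ s in Ioo 0 t, ENNReal.ofReal ((t - s) ^ (α - 1)) *
    opS α (t - s) (volume.withDensity (g s)) x

/-- The right-hand side of the integral equation, whose fixed points are the mild solutions. -/
noncomputable def mildMap (α p : ℝ) (μ : Measure (EuclideanSpace ℝ (Fin N)))
    (u : ℝ → EuclideanSpace ℝ (Fin N) → ℝ≥0∞) (t : ℝ) (x : EuclideanSpace ℝ (Fin N)) : ℝ≥0∞ :=
  opP α t μ x + duhamel α (fun s y => u s y ^ p) t x

theorem measurable_opP (α : ℝ) (μ : Measure (EuclideanSpace ℝ (Fin N))) [SFinite μ] :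
    Measurable (Function.uncurry fun t x => opP α t μ x) :=
  measurable_subordinatedHeat (f := fun q : ℝ × EuclideanSpace ℝ (Fin N) => q.1 ^ α)
    (measurable_wrightDensity α).ennreal_ofReal (by fun_prop)

theorem measurable_opS_withDensity (α : ℝ) {Y : Type*} [MeasurableSpace Y] {f : Y → ℝ}
    {F : Y → EuclideanSpace ℝ (Fin N) → ℝ≥0∞} {g : Y → EuclideanSpace ℝ (Fin N)}
    (hf : Measurable f) (hF : Measurable (Function.uncurry F)) (hg : Measurable g) :
    Measurable fun a => opS α (f a) (volume.withDensity (F a)) (g a) := by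
  have hw := measurable_wrightDensity α
  have hF' : Measurable (Function.uncurry fun (r : Y × ℝ) y => F r.1 y) := by
    simp only [Function.uncurry_def]
    fun_prop
  exact measurable_subordinatedHeat (f := fun a => f a ^ α) (by fun_prop)
    (measurable_heatSemigroup_withDensity (by fun_prop) hF' (by fun_prop))

theorem measurable_duhamel_integrand (α : ℝ) {g : ℝ → EuclideanSpace ℝ (Fin N) → ℝ≥0∞}
    (hg : Measurable (Function.uncurry g)) :
    Measurable fun r : (ℝ × EuclideanSpace ℝ (Fin N)) × ℝ =>
      ENNReal.ofReal ((r.1.1 - r.2) ^ (α - 1)) *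
        opS α (r.1.1 - r.2) (volume.withDensity (g r.2)) r.1.2 := by
  have hg' : Measurable (Function.uncurry
      fun (r : (ℝ × EuclideanSpace ℝ (Fin N)) × ℝ) y => g r.2 y) := by
    simp only [Function.uncurry_def]
    fun_prop
  exact .mul (by fun_prop) (measurable_opS_withDensity α (by fun_prop) hg' (by fun_prop))

theorem measurable_duhamel (α : ℝ) {g : ℝ → EuclideanSpace ℝ (Fin N) → ℝ≥0∞}
    (hg : Measurable (Function.uncurry g)) : Measurable (Function.uncurry (duhamel α g)) := by
  have hS : MeasurableSet {r : (ℝ × EuclideanSpace ℝ (Fin N)) × ℝ | r.2 ∈ Ioo 0 r.1.1} :=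
    (measurableSet_lt measurable_const measurable_snd).inter
      (measurableSet_lt measurable_snd (measurable_fst.comp measurable_fst))
  refine .const_mul ?_ _
  simp_rw [← lintegral_indicator measurableSet_Ioo]
  exact ((measurable_duhamel_integrand α hg).indicator hS).lintegral_prod_right'

theorem measurable_mildMap (α p : ℝ) (μ : Measure (EuclideanSpace ℝ (Fin N))) [SFinite μ]
    {u : ℝ → EuclideanSpace ℝ (Fin N) → ℝ≥0∞} (hu : Measurable (Function.uncurry u)) :
    Measurable (Function.uncurry (mildMap α p μ u)) :=
  (measurable_opP α μ).add (measurable_duhamel α (hu.pow_const p))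

theorem opS_withDensity_mono {f g : EuclideanSpace ℝ (Fin N) → ℝ≥0∞} (h : f ≤ g) (t : ℝ)
    (x : EuclideanSpace ℝ (Fin N)) :
    opS α t (volume.withDensity f) x ≤ opS α t (volume.withDensity g) x :=
  subordinatedHeat_mono _ _ (withDensity_mono (ae_of_all _ h)) x

theorem monotone_mildMap (hp : 0 ≤ p) (μ : Measure (EuclideanSpace ℝ (Fin N))) :
    Monotone (mildMap α p μ) := by
  intro u v huv t x
  unfold mildMap duhamel
  gcongr with s
  exact opS_withDensity_mono (fun y => ENNReal.rpow_le_rpow (huv s y) hp) _ x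

theorem duhamel_iSup {g : ℕ → ℝ → EuclideanSpace ℝ (Fin N) → ℝ≥0∞}
    (hg : ∀ n, Measurable (Function.uncurry (g n))) (hmono : Monotone g) (t : ℝ)
    (x : EuclideanSpace ℝ (Fin N)) :
    duhamel α (fun s y => ⨆ n, g n s y) t x = ⨆ n, duhamel α (g n) t x := by
  have hw := measurable_wrightDensity α
  have hopS (s : ℝ) : opS α (t - s) (volume.withDensity fun y => ⨆ n, g n s y) x =
      ⨆ n, opS α (t - s) (volume.withDensity (g n s)) x :=
    subordinatedHeat_withDensity_iSup (by fun_prop) _ (fun n => (hg n).of_uncurry_left)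
      (fun m n hmn => hmono hmn s) x
  simp only [duhamel, hopS]
  rw [← ENNReal.mul_iSup]
  congr 1
  simp only [ENNReal.mul_iSup]
  refine lintegral_iSup (fun n => ?_) fun m n hmn s => ?_
  · exact (measurable_duhamel_integrand α (hg n)).comp (measurable_prodMk_left (x := (t, x)))
  · dsimp only
    gcongr
    exact opS_withDensity_mono (hmono hmn s) _ x

theorem mildMap_iSup (hp : 0 < p) (μ : Measure (EuclideanSpace ℝ (Fin N)))
    {u : ℕ → ℝ → EuclideanSpace ℝ (Fin N) → ℝ≥0∞} (hu : ∀ n, Measurable (Function.uncurry (u n)))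
    (hmono : Monotone u) : mildMap α p μ (⨆ n, u n) = ⨆ n, mildMap α p μ (u n) := by
  have hpow (s : ℝ) (y : EuclideanSpace ℝ (Fin N)) : (⨆ n, u n s y) ^ p = ⨆ n, u n s y ^ p :=
    (ENNReal.orderIsoRpow p hp).map_iSup _
  ext t x
  simp only [mildMap, iSup_apply, hpow]
  rw [duhamel_iSup (fun n => (hu n).pow_const p)
    fun m n hmn s y => ENNReal.rpow_le_rpow (hmono hmn s y) hp.le, ENNReal.add_iSup]

/-- The Picard iterates of the integral equation, starting from `0`. -/
noncomputable def picard (α p : ℝ) (μ : Measure (EuclideanSpace ℝ (Fin N))) (n : ℕ) :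
    ℝ → EuclideanSpace ℝ (Fin N) → ℝ≥0∞ :=
  (mildMap α p μ)^[n] 0

theorem picard_succ (μ : Measure (EuclideanSpace ℝ (Fin N))) (n : ℕ) :
    picard α p μ (n + 1) = mildMap α p μ (picard α p μ n) :=
  Function.iterate_succ_apply' _ _ _

theorem monotone_picard (hp : 0 ≤ p) (μ : Measure (EuclideanSpace ℝ (Fin N))) :
    Monotone (picard α p μ) :=
  (monotone_mildMap hp μ).monotone_iterate_of_le_map fun _ _ => zero_le

theorem measurable_picard (μ : Measure (EuclideanSpace ℝ (Fin N))) [SFinite μ] (n : ℕ) :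
    Measurable (Function.uncurry (picard α p μ n)) := by
  induction n with
  | zero => exact measurable_const
  | succ n ih =>
    rw [picard_succ]
    exact measurable_mildMap α p μ ih

theorem mildMap_iSup_picard (hp : 0 < p) (μ : Measure (EuclideanSpace ℝ (Fin N))) [SFinite μ] :
    mildMap α p μ (⨆ n, picard α p μ n) = ⨆ n, picard α p μ n := by
  have hmono := monotone_picard (α := α) hp.le μ
  rw [mildMap_iSup hp μ (measurable_picard μ) hmono]
  simp only [← picard_succ]
  exact hmono.iSup_nat_add 1

theorem isSolution_of_mildMap_eq {T R : ℝ} (hp : 0 < p) (hR : 0 < R)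
    {μ : Measure (EuclideanSpace ℝ (Fin N))} {u : ℝ → EuclideanSpace ℝ (Fin N) → ℝ≥0∞}
    (hu : Measurable (Function.uncurry u)) (hfix : mildMap α p μ u = u)
    (hfin : ∀ t ∈ Ioc 0 T, ulocNorm p R (u t) < ∞) : IsSolution α p T μ u where
  measurable := hu.comp (measurable_subtype_coe.prodMap measurable_id)
  equation := by
    have hlt : ∀ᵐ q : ℝ × EuclideanSpace ℝ (Fin N) ∂((volume.restrict (Ioc 0 T)).prod volume),
        u q.1 q.2 < ∞ := by
      rw [Measure.ae_prod_iff_ae_ae (p := fun q => u q.1 q.2 < ∞)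
        (measurableSet_lt hu measurable_const)]
      filter_upwards [ae_restrict_mem measurableSet_Ioc] with t ht
      exact ae_lt_top_of_ulocNorm_lt_top hp hR hu.of_uncurry_left (hfin t ht)
    exact hlt.mono fun q hq => ⟨hq, (congr_fun₂ hfix q.1 q.2).symm⟩

theorem exists_isSolution_of_ulocNorm_picard_le {T R : ℝ} (hp : 0 < p) (hR : 0 < R)
    (μ : Measure (EuclideanSpace ℝ (Fin N))) [SFinite μ] (B : ℝ → ℝ≥0)
    (h : ∀ n, ∀ t ∈ Ioc 0 T, ulocNorm p R (picard α p μ n t) ≤ B t) :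
    ∃ u, IsSolution α p T μ u := by
  have hmeas : Measurable (Function.uncurry (⨆ n, picard α p μ n)) := by
    simp only [Function.uncurry_def, iSup_apply]
    exact .iSup (measurable_picard μ)
  refine ⟨_, isSolution_of_mildMap_eq hp hR hmeas (mildMap_iSup_picard hp μ) fun t ht => ?_⟩
  have hsup : (⨆ n, picard α p μ n) t = fun x => ⨆ n, picard α p μ n t x := by
    simp only [iSup_apply, funext_iff, implies_true]
  rw [hsup, ulocNorm_iSup hp (fun n => (measurable_picard μ n).of_uncurry_left)
    fun m n hmn => monotone_picard hp.le μ hmn t]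
  exact (iSup_le fun n => h n t ht).trans_lt ENNReal.coe_lt_top

end MildFormulation

section SmallData

variable {N : ℕ} {α p : ℝ}

theorem exists_ulocNorm_duhamel_le (hp : 1 ≤ p) (hβ : smoothingExponent N p < 1) :
    ∃ C : ℝ≥0, ∀ (g : ℝ → EuclideanSpace ℝ (Fin N) → ℝ≥0∞) (α R t : ℝ),
      Measurable (Function.uncurry g) → 0 < α → α < 1 → 0 ≤ R → t ^ α ≤ R ^ 2 →
        ulocNorm p R (duhamel α g t) ≤ C * (ENNReal.ofReal α * ∫⁻ s in Ioo 0 t,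
          ENNReal.ofReal ((t - s) ^ (α * (1 - smoothingExponent N p) - 1)) *
            ulocMass R (volume.withDensity (g s))) := by
  obtain ⟨C, hC⟩ := exists_ulocNorm_opS_le hp hβ
  refine ⟨C, fun g α R t hg h0 h1 hR htR => ?_⟩
  have hp0 : 0 < p := by linarith
  have hmeas : Measurable fun q : ℝ × EuclideanSpace ℝ (Fin N) =>
      ENNReal.ofReal ((t - q.1) ^ (α - 1)) * opS α (t - q.1) (volume.withDensity (g q.1)) q.2 :=
    (measurable_duhamel_integrand α hg).comp (by fun_prop :
      Measurable fun q : ℝ × EuclideanSpace ℝ (Fin N) => ((t, q.2), q.1))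
  have hpoint (s : ℝ) (hs : s ∈ Ioo 0 t) :
      ulocNorm p R (fun x => ENNReal.ofReal ((t - s) ^ (α - 1)) *
          opS α (t - s) (volume.withDensity (g s)) x) ≤
        C * (ENNReal.ofReal ((t - s) ^ (α * (1 - smoothingExponent N p) - 1)) *
          ulocMass R (volume.withDensity (g s))) := by
    have hts : 0 < t - s := sub_pos.2 hs.2
    have htsR : (t - s) ^ α ≤ R ^ 2 :=
      (Real.rpow_le_rpow hts.le (by linarith [hs.1]) h0.le).trans htR
    have hexp : (t - s) ^ (α * (1 - smoothingExponent N p) - 1) =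
        (t - s) ^ (α - 1) * (t - s) ^ (-(α * smoothingExponent N p)) := by
      rw [← Real.rpow_add hts]
      ring_nf
    have hopS : Measurable fun x => opS α (t - s) (volume.withDensity (g s)) x :=
      measurable_opS_withDensity α measurable_const
        (hg.of_uncurry_left.comp measurable_snd) measurable_id
    rw [ulocNorm_const_mul hp0 _ hopS, hexp, ENNReal.ofReal_mul (by positivity)]
    grw [hC (volume.withDensity (g s)) α R (t - s) h0 h1 hR hts htsR]
    exact le_of_eq (by ring)
  unfold duhamel
  rw [ulocNorm_const_mul hp0 _ hmeas.lintegral_prod_left', mul_left_comm,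
    ← lintegral_const_mul' _ _ ENNReal.coe_ne_top]
  gcongr
  exact (ulocNorm_lintegral_le hp hmeas).trans (setLIntegral_mono' measurableSet_Ioo hpoint)

theorem ofReal_mul_lintegral_sub_rpow_mul_rpow_le {α β κ t T : ℝ} (h0 : 0 < α) (h1 : α < 1)
    (hβ : β < 1) (hκ0 : 0 ≤ κ) (hκ1 : κ ≤ 1) (ht : t ∈ Ioc 0 T) :
    ENNReal.ofReal α *
        ∫⁻ s in Ioo 0 t, ENNReal.ofReal ((t - s) ^ (α * (1 - β) - 1) * s ^ (-(α * κ))) ≤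
      ENNReal.ofReal ((1 + 1 / (1 - β)) * (T ^ (α * (1 - κ)) / (1 - α * κ)) * t ^ (-(α * β))) := by
  have ht0 : 0 < t := ht.1
  have hβ' : 0 < 1 - β := by linarith
  have hακ : α * κ < 1 := by nlinarith
  have hακ' : 0 < 1 - α * κ := by linarith
  have ha : 0 < α * (1 - β) := by positivity
  grw [lintegral_sub_rpow_mul_rpow_le ht0 (by linarith) (by linarith)]
  rw [← ENNReal.ofReal_mul h0.le]
  refine ENNReal.ofReal_le_ofReal ?_
  have htT : t ^ (α * (1 - κ)) ≤ T ^ (α * (1 - κ)) :=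
    Real.rpow_le_rpow ht0.le ht.2 (mul_nonneg h0.le (by linarith))
  have hcoef : α * (1 / (α * (1 - β)) + 1 / (1 - α * κ)) ≤ (1 + 1 / (1 - β)) / (1 - α * κ) := by
    have hinv : 1 / (1 - β) ≤ 1 / (1 - β) / (1 - α * κ) :=
      le_div_self (by positivity) hακ' (by nlinarith)
    calc α * (1 / (α * (1 - β)) + 1 / (1 - α * κ))
        = 1 / (1 - β) + α / (1 - α * κ) := by field_simp
      _ ≤ 1 / (1 - β) / (1 - α * κ) + 1 / (1 - α * κ) := by gcongr
      _ = _ := by ring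
  calc α * (t ^ (α * (1 - β) - 1 + -(α * κ) + 1) *
        (1 / (α * (1 - β) - 1 + 1) + 1 / (-(α * κ) + 1)))
      = t ^ (α * (1 - κ)) * t ^ (-(α * β)) * (α * (1 / (α * (1 - β)) + 1 / (1 - α * κ))) := by
        rw [← Real.rpow_add ht0]
        ring_nf
    _ ≤ T ^ (α * (1 - κ)) * t ^ (-(α * β)) * ((1 + 1 / (1 - β)) / (1 - α * κ)) := by
        have : 0 < T := ht0.trans_le ht.2
        gcongr
    _ = _ := by ring

theorem exists_ulocNorm_duhamel_rpow_le (hp : 1 < p) (hβ : smoothingExponent N p * p ≤ 1) :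
    ∃ C : ℝ, 0 ≤ C ∧ ∀ (u : ℝ → EuclideanSpace ℝ (Fin N) → ℝ≥0∞) (α K R T : ℝ),
      Measurable (Function.uncurry u) → 0 < α → α < 1 → 0 ≤ K → 0 ≤ R → T ^ α ≤ R ^ 2 →
      (∀ s ∈ Ioc 0 T, ulocNorm p R (u s) ≤
        ENNReal.ofReal (K * s ^ (-(α * smoothingExponent N p)))) →
      ∀ t ∈ Ioc 0 T, ulocNorm p R (duhamel α (fun s y => u s y ^ p) t) ≤
        ENNReal.ofReal (C * (K ^ p * (T ^ (α * (1 - smoothingExponent N p * p)) /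
          (1 - α * (smoothingExponent N p * p)))) * t ^ (-(α * smoothingExponent N p))) := by
  have hp0 : 0 < p := by linarith
  have hβ0 := smoothingExponent_nonneg (N := N) hp.le
  have hβ1 := smoothingExponent_lt_one hp hβ
  obtain ⟨C, hC⟩ := exists_ulocNorm_duhamel_le hp.le hβ1
  set β := smoothingExponent N p
  have : 0 < 1 - β := by linarith
  refine ⟨C * (1 + 1 / (1 - β)), by positivity, fun u α K R T hu h0 h1 hK hR hTR hus t ht => ?_⟩
  have htR : t ^ α ≤ R ^ 2 := (Real.rpow_le_rpow ht.1.le ht.2 h0.le).trans hTR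
  have hmass (s : ℝ) (hs : s ∈ Ioo 0 t) :
      ENNReal.ofReal ((t - s) ^ (α * (1 - β) - 1)) *
          ulocMass R (volume.withDensity fun y => u s y ^ p) ≤
        ENNReal.ofReal (K ^ p) *
          ENNReal.ofReal ((t - s) ^ (α * (1 - β) - 1) * s ^ (-(α * (β * p)))) := by
    have hs0 : 0 < s := hs.1
    have hts : 0 < t - s := sub_pos.2 hs.2
    rw [ulocMass_withDensity_rpow hp0]
    grw [hus s ⟨hs0, hs.2.le.trans ht.2⟩]
    rw [ENNReal.ofReal_rpow_of_nonneg (by positivity) hp0.le, Real.mul_rpow hK (by positivity),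
      ← Real.rpow_mul hs0.le, ← ENNReal.ofReal_mul (by positivity),
      ← ENNReal.ofReal_mul (by positivity)]
    exact le_of_eq (by ring_nf)
  calc ulocNorm p R (duhamel α (fun s y => u s y ^ p) t)
      ≤ C * (ENNReal.ofReal α * ∫⁻ s in Ioo 0 t, ENNReal.ofReal (K ^ p) *
          ENNReal.ofReal ((t - s) ^ (α * (1 - β) - 1) * s ^ (-(α * (β * p))))) := by
        refine (hC (fun s y => u s y ^ p) α R t (hu.pow_const p) h0 h1 hR htR).trans ?_
        gcongr _ * (_ * ?_)
        exact setLIntegral_mono' measurableSet_Ioo hmass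
    _ = C * ENNReal.ofReal (K ^ p) * (ENNReal.ofReal α * ∫⁻ s in Ioo 0 t,
          ENNReal.ofReal ((t - s) ^ (α * (1 - β) - 1) * s ^ (-(α * (β * p))))) := by
        rw [lintegral_const_mul' _ _ ENNReal.ofReal_ne_top]
        ring
    _ ≤ C * ENNReal.ofReal (K ^ p) * ENNReal.ofReal ((1 + 1 / (1 - β)) *
          (T ^ (α * (1 - β * p)) / (1 - α * (β * p))) * t ^ (-(α * β))) := by
        grw [ofReal_mul_lintegral_sub_rpow_mul_rpow_le h0 h1 hβ1 (by positivity) hβ ht]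
    _ = _ := by
        rw [← ENNReal.ofReal_coe_nnreal, ← ENNReal.ofReal_mul C.coe_nonneg,
          ← ENNReal.ofReal_mul (by positivity)]
        ring_nf

theorem exists_ulocNorm_mildMap_le (hp : 1 < p) (hβ : smoothingExponent N p * p ≤ 1) :
    ∃ C : ℝ, 0 < C ∧ ∀ (μ : Measure (EuclideanSpace ℝ (Fin N))) [SFinite μ]
      (u : ℝ → EuclideanSpace ℝ (Fin N) → ℝ≥0∞) (α A K R T : ℝ),
      Measurable (Function.uncurry u) → 0 < α → α < 1 → 0 ≤ A → 0 ≤ K → 0 ≤ R → T ^ α ≤ R ^ 2 →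
      ulocMass R μ ≤ ENNReal.ofReal A →
      (∀ s ∈ Ioc 0 T, ulocNorm p R (u s) ≤
        ENNReal.ofReal (K * s ^ (-(α * smoothingExponent N p)))) →
      ∀ t ∈ Ioc 0 T, ulocNorm p R (mildMap α p μ u t) ≤
        ENNReal.ofReal (C * (A + K ^ p * (T ^ (α * (1 - smoothingExponent N p * p)) /
          (1 - α * (smoothingExponent N p * p)))) * t ^ (-(α * smoothingExponent N p))) := by
  obtain ⟨C₁, hC₁⟩ := exists_ulocNorm_opP_le hp.le (smoothingExponent_lt_one hp hβ)
  obtain ⟨C₂, hC₂0, hC₂⟩ := exists_ulocNorm_duhamel_rpow_le hp hβ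
  have hβ0 := smoothingExponent_nonneg (N := N) hp.le
  set β := smoothingExponent N p
  refine ⟨C₁ + C₂ + 1, by positivity,
    fun μ _ u α A K R T hu h0 h1 hA hK hR hTR hμ hus t ht => ?_⟩
  have ht0 : 0 < t := ht.1
  have hT : 0 < T := ht0.trans_le ht.2
  have htR : t ^ α ≤ R ^ 2 := (Real.rpow_le_rpow ht0.le ht.2 h0.le).trans hTR
  have : 0 < 1 - α * (β * p) := by nlinarith [mul_nonneg hβ0 (by linarith : 0 ≤ p)]
  set X := K ^ p * (T ^ (α * (1 - β * p)) / (1 - α * (β * p)))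
  have hX : 0 ≤ X := by positivity
  calc ulocNorm p R (mildMap α p μ u t)
      ≤ ulocNorm p R (opP α t μ) + ulocNorm p R (duhamel α (fun s y => u s y ^ p) t) :=
        ulocNorm_add_le hp.le (measurable_opP α μ).of_uncurry_left
          (measurable_duhamel α (hu.pow_const p)).of_uncurry_left
    _ ≤ C₁ * ENNReal.ofReal (t ^ (-(α * β))) * ENNReal.ofReal A +
          ENNReal.ofReal (C₂ * X * t ^ (-(α * β))) := by
        grw [hC₁ μ α R t h0 h1 hR ht0 htR, hC₂ u α K R T hu h0 h1 hK hR hTR hus t ht, hμ]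
    _ = ENNReal.ofReal ((C₁ * A + C₂ * X) * t ^ (-(α * β))) := by
        rw [← ENNReal.ofReal_coe_nnreal, ← ENNReal.ofReal_mul C₁.coe_nonneg,
          ← ENNReal.ofReal_mul (by positivity),
          ← ENNReal.ofReal_add (by positivity) (by positivity)]
        ring_nf
    _ ≤ _ := by
        refine ENNReal.ofReal_le_ofReal (mul_le_mul_of_nonneg_right ?_ (by positivity))
        nlinarith [mul_nonneg C₁.coe_nonneg hX, mul_nonneg hC₂0 hA]

theorem mul_rpow_mul_eq_self {D X p : ℝ} (hD : 0 < D) (hX : 0 < X) (hp : p ≠ 1) :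
    (D * (D ^ p * X) ^ (-(1 / (p - 1)))) ^ p * X = (D ^ p * X) ^ (-(1 / (p - 1))) := by
  have hp' : p - 1 ≠ 0 := sub_ne_zero.2 hp
  have hY : 0 < D ^ p * X := by positivity
  rw [Real.mul_rpow hD.le (by positivity), mul_right_comm, ← Real.rpow_mul hY.le]
  nth_rw 1 [← Real.rpow_one (D ^ p * X)]
  rw [← Real.rpow_add hY]
  congr 1
  field_simp
  ring

theorem exists_isSolution_of_ulocMass_le (hp : 1 < p) (hβ : smoothingExponent N p * p ≤ 1) :
    ∃ D : ℝ, 0 < D ∧ ∀ (μ : Measure (EuclideanSpace ℝ (Fin N))) [SFinite μ] (α T : ℝ),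
      0 < α → α < 1 → 0 < T →
      ulocMass (T ^ (α / 2)) μ ≤
        ENNReal.ofReal ((D ^ p * (T ^ (α * (1 - smoothingExponent N p * p)) /
          (1 - α * (smoothingExponent N p * p)))) ^ (-(1 / (p - 1)))) →
      ∃ u, IsSolution α p T μ u := by
  obtain ⟨C, hC, H⟩ := exists_ulocNorm_mildMap_le hp hβ
  have hβ0 := smoothingExponent_nonneg (N := N) hp.le
  set β := smoothingExponent N p
  refine ⟨2 * C, by positivity, fun μ _ α T h0 h1 hT hμ => ?_⟩
  have : 0 < 1 - α * (β * p) := by nlinarith [mul_nonneg hβ0 (by linarith : 0 ≤ p)]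
  have hfix := mul_rpow_mul_eq_self (D := 2 * C) (p := p)
    (X := T ^ (α * (1 - β * p)) / (1 - α * (β * p))) (by positivity) (by positivity) hp.ne'
  have hA : 0 < ((2 * C) ^ p * (T ^ (α * (1 - β * p)) / (1 - α * (β * p)))) ^ (-(1 / (p - 1))) := by
    positivity
  set A := ((2 * C) ^ p * (T ^ (α * (1 - β * p)) / (1 - α * (β * p)))) ^ (-(1 / (p - 1)))
  have hR : T ^ α ≤ (T ^ (α / 2)) ^ 2 := by
    rw [← Real.rpow_mul_natCast hT.le]
    norm_num
  refine exists_isSolution_of_ulocNorm_picard_le (R := T ^ (α / 2)) (by linarith) (by positivity) μ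
    (fun t => (2 * C * A * t ^ (-(α * β))).toNNReal) fun n => ?_
  induction n with
  | zero =>
    intro t _
    simp [picard, ulocNorm, show 0 < p by linarith]
  | succ n ih =>
    intro t ht
    rw [picard_succ]
    refine (H μ _ α A (2 * C * A) _ T (measurable_picard μ n) h0 h1 hA.le (by positivity)
      (by positivity) hR hμ ih t ht).trans_eq ?_
    rw [hfix, ENNReal.ofReal]
    ring_nf

theorem mul_rpow_div_rpow_neg {D b T n p : ℝ} (hD : 0 < D) (hb : 0 < b) (hT : 0 < T) (hp : p ≠ 1)
    (α : ℝ) :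
    (D ^ p * (T ^ (α * (1 - n * (p - 1))) / b)) ^ (-(1 / (p - 1))) =
      D ^ (-(p / (p - 1))) * b ^ (1 / (p - 1)) * T ^ (α * (n - 1 / (p - 1))) := by
  have hexpD : p * -(1 / (p - 1)) = -(p / (p - 1)) := by ring
  have hexpT : α * (1 - n * (p - 1)) * -(1 / (p - 1)) = α * (n - 1 / (p - 1)) := by
    have : p - 1 ≠ 0 := sub_ne_zero.2 hp
    field_simp
    ring
  rw [Real.mul_rpow (by positivity) (by positivity), Real.div_rpow (by positivity) hb.le,
    ← Real.rpow_mul hD.le, ← Real.rpow_mul hT.le, hexpD, hexpT, Real.rpow_neg hb.le,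
    div_inv_eq_mul, mul_comm (T ^ _), ← mul_assoc]

/-- The dependence on `α` of the smallness threshold for the initial measure. The base
`1 - α N (p - 1) / 2` measures how far `s ^ (-α β p)`, with `β = smoothingExponent N p`, is from the
critical nonintegrable power at `s = 0`; at `p = p_F` it vanishes as `α → 1`. -/
noncomputable def smallnessRate (N : ℕ) (p α : ℝ) : ℝ :=
  (1 - α * ((N : ℝ) / 2 * (p - 1))) ^ (1 / (p - 1))

theorem exists_isSolution_of_small (hp : 1 < p) (hN : (N : ℝ) / 2 * (p - 1) ≤ 1) :
    ∃ c : ℝ, 0 < c ∧ ∀ (μ : Measure (EuclideanSpace ℝ (Fin N))) [SFinite μ] (α T : ℝ),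
      0 < α → α < 1 → 0 < T →
      ulocMass (T ^ (α / 2)) μ ≤
        ENNReal.ofReal (c * smallnessRate N p α * T ^ (α * ((N : ℝ) / 2 - 1 / (p - 1)))) →
      ∃ u, IsSolution α p T μ u := by
  have hβ : smoothingExponent N p * p = (N : ℝ) / 2 * (p - 1) :=
    smoothingExponent_mul_self (by linarith)
  obtain ⟨D, hD, H⟩ := exists_isSolution_of_ulocMass_le hp (hβ.trans_le hN)
  refine ⟨D ^ (-(p / (p - 1))), by positivity, fun μ _ α T h0 h1 hT hμ => ?_⟩
  have hb : 0 < 1 - α * ((N : ℝ) / 2 * (p - 1)) := by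
    nlinarith
  refine H μ α T h0 h1 hT ?_
  rwa [hβ, mul_rpow_div_rpow_neg hD hb hT hp.ne']

end SmallData

section FujitaExponent

variable {N : ℕ} {p : ℝ}

theorem half_mul_sub_one_le_iff (hN : 1 ≤ N) :
    (N : ℝ) / 2 * (p - 1) ≤ 1 ↔ p ≤ fujitaExponent N := by
  have : (0 : ℝ) < N := by positivity
  rw [← le_div_iff₀' (by positivity), one_div_div, fujitaExponent, sub_le_iff_le_add']

theorem half_mul_sub_one_lt_iff (hN : 1 ≤ N) :
    (N : ℝ) / 2 * (p - 1) < 1 ↔ p < fujitaExponent N := by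
  have : (0 : ℝ) < N := by positivity
  rw [← lt_div_iff₀' (by positivity), one_div_div, fujitaExponent, sub_lt_iff_lt_add']

theorem one_lt_fujitaExponent (hN : 1 ≤ N) : 1 < fujitaExponent N :=
  lt_add_of_pos_right 1 (by positivity)

theorem smallnessRate_pos {α : ℝ} (h : α * ((N : ℝ) / 2 * (p - 1)) < 1) :
    0 < smallnessRate N p α :=
  Real.rpow_pos_of_pos (sub_pos.2 h) _

theorem continuousAt_smallnessRate {α : ℝ} (h : α * ((N : ℝ) / 2 * (p - 1)) ≠ 1) :
    ContinuousAt (smallnessRate N p) α :=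
  .rpow_const (by fun_prop) (.inl (sub_ne_zero.2 h.symm))

theorem smallnessRate_fujitaExponent (hN : 1 ≤ N) (α : ℝ) :
    smallnessRate N (fujitaExponent N) α = (1 - α) ^ ((N : ℝ) / 2) := by
  have : (N : ℝ) ≠ 0 := by positivity
  rw [smallnessRate, fujitaExponent, add_sub_cancel_left, one_div_div]
  congr 1
  field_simp

end FujitaExponent

end TimeFractional

theorem theorem1p2 :
    ∃ γ₂ : ℕ → ℝ → ℝ → ℝ,
      (∀ (N : ℕ) (p α : ℝ), 1 ≤ N → 1 < p → p ≤ TimeFractional.fujitaExponent N → 0 < α → α < 1 →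
        0 < γ₂ N p α ∧
        ∀ T : ℝ, 0 < T →
          ∀ (μ : Measure (EuclideanSpace ℝ (Fin N))) [IsLocallyFiniteMeasure μ],
            (⨆ z, μ (Metric.ball z (T ^ (α / 2)))) ≤
              ENNReal.ofReal (γ₂ N p α * T ^ (α * ((N : ℝ) / 2 - 1 / (p - 1)))) →
            ∃ u : ℝ → EuclideanSpace ℝ (Fin N) → ℝ≥0∞, TimeFractional.IsSolution α p T μ u) ∧
      (∀ (N : ℕ) (p : ℝ), 1 ≤ N → 1 < p → p < TimeFractional.fujitaExponent N →
        Filter.limsup (fun α : ℝ => ((γ₂ N p α : ℝ) : EReal)) (𝓝[<] (1 : ℝ)) ∈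
          Ioo (0 : EReal) ⊤) ∧
      (∀ N : ℕ, 1 ≤ N → ∃ c C : ℝ, 0 < c ∧ 0 < C ∧
        (∀ α : ℝ, 0 < α → α < 1 →
          γ₂ N (TimeFractional.fujitaExponent N) α ≤ C * (1 - α) ^ ((N : ℝ) / 2)) ∧
        ∀ᶠ α : ℝ in 𝓝[<] (1 : ℝ),
          c * (1 - α) ^ ((N : ℝ) / 2) ≤ γ₂ N (TimeFractional.fujitaExponent N) α) := by
  choose! c hc using fun N p => TimeFractional.exists_isSolution_of_small (N := N) (p := p)
  refine ⟨fun N p α => c N p * TimeFractional.smallnessRate N p α, ?_, ?_, ?_⟩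
  · intro N p α hN hp hpF h0 h1
    have hNp := (TimeFractional.half_mul_sub_one_le_iff hN).2 hpF
    obtain ⟨hc0, hsol⟩ := hc N p hp hNp
    exact ⟨mul_pos hc0 (TimeFractional.smallnessRate_pos (by nlinarith)),
      fun T hT μ _ hμ => hsol μ α T h0 h1 hT hμ⟩
  · intro N p hN hp hpF
    have hNp := (TimeFractional.half_mul_sub_one_lt_iff hN).2 hpF
    have hlim : Tendsto (fun α => ((c N p * TimeFractional.smallnessRate N p α : ℝ) : EReal))
        (𝓝[<] 1) (𝓝 ((c N p * TimeFractional.smallnessRate N p 1 : ℝ) : EReal)) :=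
      EReal.tendsto_coe.2 <| .const_mul _ <|
        (TimeFractional.continuousAt_smallnessRate (by linarith)).continuousWithinAt
    rw [hlim.limsup_eq]
    exact ⟨EReal.coe_pos.2 <| mul_pos (hc N p hp hNp.le).1 <|
      TimeFractional.smallnessRate_pos (by linarith), EReal.coe_lt_top _⟩
  · intro N hN
    have hc0 := (hc N _ (TimeFractional.one_lt_fujitaExponent hN)
      ((TimeFractional.half_mul_sub_one_le_iff hN).2 le_rfl)).1
    simp only [TimeFractional.smallnessRate_fujitaExponent hN]
    exact ⟨c N _, c N _, hc0, hc0, fun _ _ _ => le_rfl, .of_forall fun _ => le_rfl⟩
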